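/- Let $\phi\colon\mathbf{R}\to\mathbf{R}$ be a Lipschitz function, $\Omega=\{X=(x,t)\in\mathbf{R}^2 : \phi(x)<t\}$, and let $\sigma$ be the surface (arc length) measure on $\partial\Omega$. Let $\widetilde W^{1,2}(\Omega)$ be the space of functions $f$ on $\Omega$ with locally integrable distributional gradient and finite norm $$\|f\|_{\widetilde W^{1,2}(\Omega)}=\Big(\iint_\Omega |f(X)|^2\frac{dX}{1+|X|^2}+\iint_\Omega|\nabla f(X)|^2\,dX\Big)^{1/2},$$ let $\widetilde L^2(\partial\Omega)$ be the space with norm $\|g\|_{\widetilde L^2(\partial\Omega)}=\big(\int_{\partial\Omega}|g(X)|^2\frac{d\sigma(X)}{1+|X|}\big)^{1/2}$, let $\mathrm{Tr}\colon\widetilde W^{1,2}(\Omega)\to\widetilde L^2(\partial\Omega)$ be the continuous extension of the restriction map $\varphi\mapsto\varphi|_{\partial\Omega}$ on functions smooth up to the boundary, and let $\widetilde W^{1,2}_0(\Omega)=\{f\in\widetilde W^{1,2}(\Omega):\mathrm{Tr}(f)=0\}$. Let $W^{1,2}(\partial\Omega)$ be the space of $f\in L^2(\partial\Omega)$ whose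 distributional tangential derivative $\partial_\tau f$ belongs to $L^2(\partial\Omega)$, with $\|f\|_{W^{1,2}(\partial\Omega)}=(\|f\|_{L^2(\partial\Omega)}^2+\|\partial_\tau f\|_{L^2(\partial\Omega)}^2)^{1/2}$. Let $\lambda>0$ and $\Lambda$ be real numbers. There is a constant $C$, depending only on $\lambda$, $\Lambda$ and $\Omega$, such that the following holds. Let $A=(a_{ij})$ be any (not necessarily symmetric) $2\times2$ matrix of real-valued measurable functions on $\Omega$ with $\max_{i,j}\|a_{ij}\|_{L^\infty(\Omega)}\le\Lambda$ and $\lambda|\xi|^2\le\xi\cdot A(X)\xi$ for almost every $X\in\Omega$ and all $\xi\in\mathbf{R}^2$. Then for every $f_0\in W^{1,2}(\partial\Omega)\cap L^{7/6}(\partial\Omega)\cap L^{17/6}(\partial\Omega)$ there exists a unique $u\in\widetilde W^{1,2}(\Omega)$ such that $\mathrm{Tr}(u)=f_0$ and $$\iint_\Omega A\nabla u\cdot\nabla\varphi=0\qquad\text{for all }\varphi\in\widetilde W^{1,2}_0(\Omega),$$ and moreover $$\|u\|_{\widetilde W^{1,2}(\Omega)}\le C\big(\|f_0\|_{W^{1,2}(\partial\Omega)}+\|f_0\|_{L^{7/6}(\partial\Omega)}+\|f_0\|_{L^{17/6}(\partial\Omega)}\big).$$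 -/

import Mathlib

open MeasureTheory Filter Topology Matrix
open scoped NNReal ENNReal ContDiff

noncomputable section

namespace LipGraph

/-- The domain `{(x, t) | φ x < t}` above the graph of `φ`. -/
def region (φ : ℝ → ℝ) : Set (ℝ × ℝ) := {X | φ X.1 < X.2}

/-- The square of the Euclidean length `|X|` of a point of the plane (the norm that `ℝ × ℝ`
carries in Mathlib is the maximum norm and is not used). -/
def euclSq (X : ℝ × ℝ) : ℝ := X.1 ^ 2 + X.2 ^ 2

/-- The coordinate directions of the plane. -/
def dir : Fin 2 → ℝ × ℝ := ![(1, 0), (0, 1)]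

/-- `G` is the gradient of `u` on the open set `Ω` in the sense of distributions. -/
def IsWeakGrad (Ω : Set (ℝ × ℝ)) (u : ℝ × ℝ → ℝ) (G : ℝ × ℝ → Fin 2 → ℝ) : Prop :=
  LocallyIntegrableOn u Ω volume ∧
  (∀ i, LocallyIntegrableOn (fun X => G X i) Ω volume) ∧
  ∀ ψ : ℝ × ℝ → ℝ, ContDiff ℝ ∞ ψ → HasCompactSupport ψ → tsupport ψ ⊆ Ω →
    ∀ i, ∫ X in Ω, u X * fderiv ℝ ψ X (dir i) = -∫ X in Ω, G X i * ψ X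

open Classical in
/-- The distributional gradient of `u` on `Ω`, for `u` that has one among the locally integrable
functions; it is determined almost everywhere on `Ω`. -/
def weakGrad (Ω : Set (ℝ × ℝ)) (u : ℝ × ℝ → ℝ) : ℝ × ℝ → Fin 2 → ℝ :=
  if h : ∃ G, IsWeakGrad Ω u G then h.choose else 0

open Classical in
/-- The weighted Sobolev norm
`(∬_Ω |u|² dX / (1 + |X|²) + ∬_Ω |∇u|² dX)^(1/2)`; it is `⊤` if `u` has no gradient among the
locally integrable functions. -/
def sobNorm (Ω : Set (ℝ × ℝ)) (u : ℝ × ℝ → ℝ) : ℝ≥0∞ :=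
  if ∃ G, IsWeakGrad Ω u G then
    ((∫⁻ X in Ω, ENNReal.ofReal (u X ^ 2 / (1 + euclSq X))) +
      ∫⁻ X in Ω, ENNReal.ofReal (weakGrad Ω u X ⬝ᵥ weakGrad Ω u X)) ^ (1 / 2 : ℝ)
  else ⊤

/-- Membership in the weighted Sobolev space of functions on `Ω` (whose elements are functions
up to equality almost everywhere on `Ω`). -/
def MemSob (Ω : Set (ℝ × ℝ)) (u : ℝ × ℝ → ℝ) : Prop := sobNorm Ω u < ⊤

/-- Surface measure (arc length) on the graph of the Lipschitz function `φ`, as a measure on the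
plane carried by the graph. -/
def surf (φ : ℝ → ℝ) : Measure (ℝ × ℝ) :=
  (volume.withDensity fun x => ENNReal.ofReal (√(1 + deriv φ x ^ 2))).map fun x => (x, φ x)

/-- The unit tangent `(1, φ') / (1 + (φ')²)^(1/2)` to the graph of `φ` at `(x, φ x)`. -/
def tangent (φ : ℝ → ℝ) (x : ℝ) : ℝ × ℝ :=
  (1 / √(1 + deriv φ x ^ 2)) • ((1, deriv φ x) : ℝ × ℝ)

/-- `h` is the derivative of `f` along the graph of `φ` in the sense of distributions. Only the
values of `f` and `h` on the graph matter. -/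
def IsWeakTangDeriv (φ : ℝ → ℝ) (f h : ℝ × ℝ → ℝ) : Prop :=
  LocallyIntegrable f (surf φ) ∧ LocallyIntegrable h (surf φ) ∧
  ∀ ψ : ℝ × ℝ → ℝ, ContDiff ℝ ∞ ψ → HasCompactSupport ψ →
    ∫ X, f X * fderiv ℝ ψ X (tangent φ X.1) ∂(surf φ) = -∫ X, h X * ψ X ∂(surf φ)

open Classical in
/-- The distributional derivative of `f` along the graph of `φ`, determined almost everywhere for
the surface measure. -/
def weakTangDeriv (φ : ℝ → ℝ) (f : ℝ × ℝ → ℝ) : ℝ × ℝ → ℝ :=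
  if h : ∃ g, IsWeakTangDeriv φ f g then h.choose else 0

open Classical in
/-- The norm of `W^{1,2}` of the graph of `φ`. -/
def bdrySobNorm (φ : ℝ → ℝ) (f : ℝ × ℝ → ℝ) : ℝ≥0∞ :=
  if ∃ g, IsWeakTangDeriv φ f g then
    (eLpNorm f 2 (surf φ) ^ 2 + eLpNorm (weakTangDeriv φ f) 2 (surf φ) ^ 2) ^ (1 / 2 : ℝ)
  else ⊤

/-- The weighted norm `(∫_{∂Ω} |g|² dσ / (1 + |X|))^(1/2)` on the graph of `φ`. -/
def bdryNorm (φ : ℝ → ℝ) (g : ℝ × ℝ → ℝ) : ℝ≥0∞ :=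
  (∫⁻ X, ENNReal.ofReal (g X ^ 2 / (1 + √(euclSq X))) ∂(surf φ)) ^ (1 / 2 : ℝ)

/-- `Tr u = g`: the pair `(u, g)` lies in the closure, for the weighted norms on the domain and on
the boundary, of the graph of the restriction map `ψ ↦ ψ|_{∂Ω}` on the smooth functions (up to the
boundary) of the weighted Sobolev space. This closure is the graph of the continuous extension. -/
def HasTrace (φ : ℝ → ℝ) (u g : ℝ × ℝ → ℝ) : Prop :=
  ∃ ψ : ℕ → ℝ × ℝ → ℝ,
    (∀ n, ContDiff ℝ ∞ (ψ n) ∧ MemSob (region φ) (ψ n)) ∧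
    Tendsto (fun n => sobNorm (region φ) (ψ n - u)) atTop (𝓝 0) ∧
    Tendsto (fun n => bdryNorm φ (ψ n - g)) atTop (𝓝 0)

/-- Membership in the subspace of functions of vanishing trace. -/
def MemSobZero (φ : ℝ → ℝ) (v : ℝ × ℝ → ℝ) : Prop :=
  MemSob (region φ) v ∧ HasTrace φ v 0

/-- `A` is a measurable matrix field on `Ω` with entries bounded by `Lam`, uniformly elliptic with
constant `lam`. It need not be symmetric. -/
structure IsEllipticCoeff (Ω : Set (ℝ × ℝ)) (lam Lam : ℝ)
    (A : ℝ × ℝ → Matrix (Fin 2) (Fin 2) ℝ) : Prop where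
  measurable : ∀ i j, AEMeasurable (fun X => A X i j) (volume.restrict Ω)
  bounded : ∀ i j, ∀ᵐ X ∂(volume.restrict Ω), |A X i j| ≤ Lam
  elliptic : ∀ᵐ X ∂(volume.restrict Ω), ∀ ξ : Fin 2 → ℝ, lam * (ξ ⬝ᵥ ξ) ≤ ξ ⬝ᵥ (A X *ᵥ ξ)

/-- `u` lies in the weighted Sobolev space, has trace `f₀`, and satisfies
`∬_Ω A∇u · ∇v = 0` for every `v` in the space with vanishing trace. -/
def SolvesDirichlet (φ : ℝ → ℝ) (A : ℝ × ℝ → Matrix (Fin 2) (Fin 2) ℝ)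
    (f₀ u : ℝ × ℝ → ℝ) : Prop :=
  MemSob (region φ) u ∧ HasTrace φ u f₀ ∧
  ∀ v, MemSobZero φ v →
    ∫ X in region φ, (A X *ᵥ weakGrad (region φ) u X) ⬝ᵥ weakGrad (region φ) v X = 0

end LipGraph

end

open LipGraph

noncomputable section

namespace LipGraph

/-! ### Weak gradients -/

/-! The Dirichlet problem is solved by the Lax-Milgram theorem, in a Hilbert space where a function,
its gradient and its trace are separate components of one vector (`Ambient`). The closure
`traceSpace` of the vectors coming from smooth functions models the weighted Sobolev space with its
trace. Integration by parts against a test function is a closed condition, so a limit still consists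
of a function and its weak gradient (`Represents.isWeakGrad`). Since the ambient norm is the sum of
the interior and boundary norms, membership in this closure amounts to `HasTrace`
(`Represents.hasTrace`, `exists_mem_traceSpace`).

Coercivity is the first analytic point. Ellipticity controls only the gradient, and the weighted
norm of the function has to be recovered from it. Hardy's inequality on each vertical half-line
above the graph does this, with a boundary term that is exactly the weighted norm of the trace
(`lintegral_hardy`, `norm_interior_le`). For zero trace the boundary term vanishes and the gradient
dominates the whole norm.

The second point is an extension of the data (`exists_extension`). In the coordinate `x` the datum
becomes an element of `W^{1,2}` of the line. Its mollifications `α` extend to the smooth functions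
`α(x) η(t - θ(x))`, where `θ` is a smooth function within bounded distance of `φ` and `η` is a
cutoff. The resulting vectors form a Cauchy sequence, whose limit `F` has the right trace.

Lax-Milgram on the zero-trace subspace, which requires no symmetry, then corrects `F` to a solution
and bounds it (`exists_solution`). Two solutions differ by a zero-trace vector that may be used as a
test function, so coercivity gives uniqueness. -/

theorem isOpen_region {φ : ℝ → ℝ} (hφ : Continuous φ) : IsOpen (region φ) :=
  isOpen_lt (hφ.comp continuous_fst) continuous_snd

theorem integrable_mul_test {Ω : Set (ℝ × ℝ)} {u ψ : ℝ × ℝ → ℝ}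
    (hu : LocallyIntegrableOn u Ω volume) (hψ : Continuous ψ) (hc : HasCompactSupport ψ)
    (hs : tsupport ψ ⊆ Ω) : Integrable (fun X => u X * ψ X) volume := by
  have h1 : IntegrableOn u (tsupport ψ) volume := hu.integrableOn_compact_subset hs hc
  have h2 : IntegrableOn (fun X => u X * ψ X) (tsupport ψ) volume :=
    h1.mul_continuousOn hψ.continuousOn hc
  rw [integrableOn_iff_integrable_of_support_subset] at h2
  · exact h2
  · intro X hX
    apply subset_tsupport ψ
    rw [Function.mem_support] at hX ⊢
    exact right_ne_zero_of_mul hX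

theorem integrable_mul_fderiv_test {Ω : Set (ℝ × ℝ)} {u ψ : ℝ × ℝ → ℝ}
    (hu : LocallyIntegrableOn u Ω volume) (hψ : ContDiff ℝ ∞ ψ) (hc : HasCompactSupport ψ)
    (hs : tsupport ψ ⊆ Ω) (v : ℝ × ℝ) : Integrable (fun X => u X * fderiv ℝ ψ X v) volume :=
  integrable_mul_test hu ((hψ.continuous_fderiv (by simp)).clm_apply continuous_const)
    (hc.fderiv_apply ℝ v) ((tsupport_fderiv_apply_subset ℝ v).trans hs)

namespace IsWeakGrad

variable {Ω : Set (ℝ × ℝ)} {u v : ℝ × ℝ → ℝ} {G H : ℝ × ℝ → Fin 2 → ℝ}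

theorem sub (hu : IsWeakGrad Ω u G) (hv : IsWeakGrad Ω v H) : IsWeakGrad Ω (u - v) (G - H) := by
  refine ⟨hu.1.sub hv.1, fun i => (hu.2.1 i).sub (hv.2.1 i), fun ψ h1 h2 h3 i => ?_⟩
  have e1 := hu.2.2 ψ h1 h2 h3 i
  have e2 := hv.2.2 ψ h1 h2 h3 i
  simp only [Pi.sub_apply, sub_mul]
  rw [integral_sub (integrable_mul_fderiv_test hu.1 h1 h2 h3 _).integrableOn
      (integrable_mul_fderiv_test hv.1 h1 h2 h3 _).integrableOn,
    integral_sub (integrable_mul_test (hu.2.1 i) h1.continuous h2 h3).integrableOn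
      (integrable_mul_test (hv.2.1 i) h1.continuous h2 h3).integrableOn, e1, e2]
  ring

/-- The fundamental lemma of the calculus of variations, applied to the difference of the two
gradients. -/
theorem ae_eq (hΩ : IsOpen Ω) (h : IsWeakGrad Ω u G) (h' : IsWeakGrad Ω u H) (i : Fin 2) :
    (fun X => G X i) =ᵐ[volume.restrict Ω] fun X => H X i := by
  have key := hΩ.ae_eq_zero_of_integral_contDiff_smul_eq_zero ((h.2.1 i).sub (h'.2.1 i)) ?_
  · rw [EventuallyEq, ae_restrict_iff' hΩ.measurableSet]
    filter_upwards [key] with X hX hX'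
    exact sub_eq_zero.1 (hX hX')
  · intro ψ h1 h2 h3
    have e1 := h.2.2 ψ h1 h2 h3 i
    have e2 := h'.2.2 ψ h1 h2 h3 i
    have hz : ∀ f : ℝ × ℝ → ℝ, ∫ X in Ω, f X * ψ X = ∫ X, f X * ψ X := fun f =>
      setIntegral_eq_integral_of_forall_compl_eq_zero fun X hX => by
        rw [image_eq_zero_of_notMem_tsupport fun hh => hX (h3 hh), mul_zero]
    rw [e1, hz, hz, neg_inj] at e2
    simp only [Pi.sub_apply, smul_eq_mul, mul_sub]
    simp only [mul_comm (ψ _)]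
    rw [integral_sub (integrable_mul_test (h.2.1 i) h1.continuous h2 h3)
      (integrable_mul_test (h'.2.1 i) h1.continuous h2 h3), e2, sub_self]

/-- Frees later arguments from the arbitrary choice made in `weakGrad`: any known gradient may
replace it under an integral. -/
theorem weakGrad_ae_eq (hΩ : IsOpen Ω) (h : IsWeakGrad Ω u G) (i : Fin 2) :
    (fun X => weakGrad Ω u X i) =ᵐ[volume.restrict Ω] fun X => G X i := by
  have hex : ∃ G, IsWeakGrad Ω u G := ⟨G, h⟩
  have : weakGrad Ω u = hex.choose := by simp [weakGrad, hex]
  rw [this]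
  exact ae_eq hΩ hex.choose_spec h i

end IsWeakGrad

/-- The classical gradient. -/
def classGrad (ψ : ℝ × ℝ → ℝ) (X : ℝ × ℝ) (i : Fin 2) : ℝ := fderiv ℝ ψ X (dir i)

theorem continuous_classGrad {ψ : ℝ × ℝ → ℝ} (hψ : ContDiff ℝ ∞ ψ) (i : Fin 2) :
    Continuous fun X => classGrad ψ X i :=
  (hψ.continuous_fderiv (by simp)).clm_apply continuous_const

theorem classGrad_zero {ψ : ℝ × ℝ → ℝ} (hψ : ContDiff ℝ ∞ ψ) (x t : ℝ) :
    classGrad ψ (x, t) 0 = deriv (fun x => ψ (x, t)) x := by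
  have h1 : HasFDerivAt ψ (fderiv ℝ ψ (x, t)) (x, t) :=
    (hψ.differentiable (by simp) (x, t)).hasFDerivAt
  have h2 : HasDerivAt (fun x : ℝ => (x, t)) ((1 : ℝ), (0 : ℝ)) x :=
    (hasDerivAt_id x).prodMk (hasDerivAt_const x t)
  exact (h1.comp_hasDerivAt x h2).deriv.symm

theorem classGrad_one {ψ : ℝ × ℝ → ℝ} (hψ : ContDiff ℝ ∞ ψ) (x t : ℝ) :
    classGrad ψ (x, t) 1 = deriv (fun t => ψ (x, t)) t := by
  have h1 : HasFDerivAt ψ (fderiv ℝ ψ (x, t)) (x, t) :=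
    (hψ.differentiable (by simp) (x, t)).hasFDerivAt
  have h2 : HasDerivAt (fun t : ℝ => (x, t)) ((0 : ℝ), (1 : ℝ)) t :=
    (hasDerivAt_const t x).prodMk (hasDerivAt_id t)
  exact (h1.comp_hasDerivAt t h2).deriv.symm

/-- Test functions are supported inside `Ω`, so both integrals extend to the plane and no boundary
term arises. -/
theorem isWeakGrad_classGrad (Ω : Set (ℝ × ℝ)) {ψ : ℝ × ℝ → ℝ} (hψ : ContDiff ℝ ∞ ψ) :
    IsWeakGrad Ω ψ (classGrad ψ) := by
  have l1 : LocallyIntegrableOn ψ Set.univ (volume : Measure (ℝ × ℝ)) :=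
    hψ.continuous.locallyIntegrable.locallyIntegrableOn _
  have l2 : ∀ i, LocallyIntegrableOn (fun X => classGrad ψ X i) Set.univ
      (volume : Measure (ℝ × ℝ)) := fun i =>
    (continuous_classGrad hψ i).locallyIntegrable.locallyIntegrableOn _
  refine ⟨l1.mono_set (Set.subset_univ _), fun i => (l2 i).mono_set (Set.subset_univ _),
    fun χ h1 h2 h3 i => ?_⟩
  have e1 : ∫ X in Ω, ψ X * fderiv ℝ χ X (dir i) = ∫ X, ψ X * fderiv ℝ χ X (dir i) :=
    setIntegral_eq_integral_of_forall_compl_eq_zero fun X hX => by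
      have : X ∉ tsupport fun X => fderiv ℝ χ X (dir i) := fun hh =>
        hX (h3 (tsupport_fderiv_apply_subset ℝ (dir i) hh))
      rw [image_eq_zero_of_notMem_tsupport (f := fun X => fderiv ℝ χ X (dir i)) this, mul_zero]
  have e2 : ∫ X in Ω, classGrad ψ X i * χ X = ∫ X, classGrad ψ X i * χ X :=
    setIntegral_eq_integral_of_forall_compl_eq_zero fun X hX => by
      rw [image_eq_zero_of_notMem_tsupport fun hh => hX (h3 hh), mul_zero]
  rw [e1, e2]
  refine integral_mul_fderiv_eq_neg_fderiv_mul_of_integrable ?_ ?_ ?_ ?_ ?_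
  · exact integrable_mul_test (l2 i) h1.continuous h2 (Set.subset_univ _)
  · exact integrable_mul_fderiv_test l1 h1 h2 (Set.subset_univ _) _
  · exact integrable_mul_test l1 h1.continuous h2 (Set.subset_univ _)
  · exact fun X _ => hψ.differentiable (by simp) X
  · exact fun X _ => h1.differentiable (by simp) X

/-! ### The ambient Hilbert space -/

/-- The density of the interior weight. -/
def interiorWeight (X : ℝ × ℝ) : ℝ≥0∞ := ENNReal.ofReal (1 / (1 + euclSq X))

/-- The density of the boundary weight. -/
def boundaryWeight (X : ℝ × ℝ) : ℝ≥0∞ := ENNReal.ofReal (1 / (1 + √(euclSq X)))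

theorem euclSq_nonneg (X : ℝ × ℝ) : 0 ≤ euclSq X := by unfold euclSq; positivity

theorem continuous_euclSq : Continuous euclSq := by unfold euclSq; fun_prop

theorem measurable_interiorWeight : Measurable interiorWeight :=
  ((continuous_const.div (continuous_const.add continuous_euclSq) fun X =>
    (add_pos_of_pos_of_nonneg one_pos (euclSq_nonneg X)).ne').measurable).ennreal_ofReal

theorem measurable_boundaryWeight : Measurable boundaryWeight :=
  ((continuous_const.div (continuous_const.add continuous_euclSq.sqrt) fun _ =>
    (add_pos_of_pos_of_nonneg one_pos (Real.sqrt_nonneg _)).ne').measurable).ennreal_ofReal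

theorem interiorWeight_ne_zero (X : ℝ × ℝ) : interiorWeight X ≠ 0 := by
  have := euclSq_nonneg X
  rw [interiorWeight, Ne, ENNReal.ofReal_eq_zero, not_le]
  positivity

/-- The measures of the square integrability conditions: `inl i` for the components of the
gradient, `inr false` for the function and `inr true` for its trace. -/
def slotMeasure (φ : ℝ → ℝ) : Fin 2 ⊕ Bool → Measure (ℝ × ℝ)
  | .inl _ => volume.restrict (region φ)
  | .inr false => (volume.restrict (region φ)).withDensity interiorWeight
  | .inr true => (surf φ).withDensity boundaryWeight

/-- The family of a gradient, a function and a trace. -/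
def slotFun (u : ℝ × ℝ → ℝ) (G : ℝ × ℝ → Fin 2 → ℝ) (g : ℝ × ℝ → ℝ) : Fin 2 ⊕ Bool → ℝ × ℝ → ℝ
  | .inl i => fun X => G X i
  | .inr false => u
  | .inr true => g

/-- The Hilbert space of square integrable families. -/
abbrev Ambient (φ : ℝ → ℝ) : Type := PiLp 2 fun s => Lp ℝ 2 (slotMeasure φ s)

/-- `x` is the class of the family `c`. -/
def Represents {φ : ℝ → ℝ} (x : Ambient φ) (c : Fin 2 ⊕ Bool → ℝ × ℝ → ℝ) : Prop :=
  ∀ s, x s =ᵐ[slotMeasure φ s] c s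

theorem sq_eLpNorm_two {α : Type*} [MeasurableSpace α] (μ : Measure α) (f : α → ℝ) :
    eLpNorm f 2 μ ^ 2 = ∫⁻ x, ENNReal.ofReal (f x ^ 2) ∂μ := by
  have := eLpNorm_nnreal_pow_eq_lintegral (μ := μ) (f := f) (p := 2) two_ne_zero
  simp only [NNReal.coe_ofNat, ENNReal.coe_ofNat, ENNReal.rpow_ofNat] at this
  rw [this]
  refine lintegral_congr fun x => ?_
  rw [← sq_abs, ENNReal.ofReal_pow (abs_nonneg _), ← Real.norm_eq_abs, ofReal_norm]

section Represents

variable {φ : ℝ → ℝ} {x y : Ambient φ} {c d : Fin 2 ⊕ Bool → ℝ × ℝ → ℝ}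

theorem exists_rep (h : ∀ s, MemLp (c s) 2 (slotMeasure φ s)) : ∃ x : Ambient φ, Represents x c :=
  ⟨WithLp.toLp 2 fun s => (h s).toLp (c s), fun s => (h s).coeFn_toLp⟩

theorem Represents.memLp (h : Represents x c) (s) : MemLp (c s) 2 (slotMeasure φ s) :=
  (memLp_congr_ae (h s)).1 (Lp.memLp (x s))

theorem Represents.sub (h : Represents x c) (h' : Represents y d) : Represents (x - y) (c - d) := fun s =>
  (Lp.coeFn_sub (x s) (y s)).trans ((h s).sub (h' s))

theorem Represents.add (h : Represents x c) (h' : Represents y d) : Represents (x + y) (c + d) := fun s =>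
  (Lp.coeFn_add (x s) (y s)).trans ((h s).add (h' s))

theorem Represents.smul (r : ℝ) (h : Represents x c) : Represents (r • x) (r • c) := fun s =>
  (Lp.coeFn_smul r (x s)).trans ((h s).const_smul r)

theorem Represents.zero : Represents (0 : Ambient φ) 0 := fun _ => Lp.coeFn_zero _ _ _

theorem Represents.ext (h : Represents x c) (h' : Represents y c) : x = y :=
  PiLp.ext fun s => Lp.ext ((h s).trans (h' s).symm)

theorem Represents.enorm_sq (h : Represents x c) :
    ‖x‖ₑ ^ 2 = ∑ s, eLpNorm (c s) 2 (slotMeasure φ s) ^ 2 := by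
  have h1 : ‖x‖ₑ ^ 2 = ∑ s, ‖x s‖ₑ ^ 2 := by
    rw [← ofReal_norm, ← ENNReal.ofReal_pow (norm_nonneg _), PiLp.norm_sq_eq_of_L2,
      ENNReal.ofReal_sum_of_nonneg fun _ _ => by positivity]
    refine Finset.sum_congr rfl fun s _ => ?_
    rw [ENNReal.ofReal_pow (norm_nonneg _), ofReal_norm]
  rw [h1]
  refine Finset.sum_congr rfl fun s _ => ?_
  rw [Lp.enorm_def, eLpNorm_congr_ae (h s)]

end Represents

theorem slotFun_sub (u v : ℝ × ℝ → ℝ) (G H : ℝ × ℝ → Fin 2 → ℝ) (g h : ℝ × ℝ → ℝ) :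
    slotFun (u - v) (G - H) (g - h) = slotFun u G g - slotFun v H h := by
  funext s; rcases s with i | (_ | _) <;> rfl

theorem slotFun_add (u v : ℝ × ℝ → ℝ) (G H : ℝ × ℝ → Fin 2 → ℝ) (g h : ℝ × ℝ → ℝ) :
    slotFun (u + v) (G + H) (g + h) = slotFun u G g + slotFun v H h := by
  funext s; rcases s with i | (_ | _) <;> rfl

theorem slotFun_smul (r : ℝ) (u : ℝ × ℝ → ℝ) (G : ℝ × ℝ → Fin 2 → ℝ) (g : ℝ × ℝ → ℝ) :
    slotFun (r • u) (r • G) (r • g) = r • slotFun u G g := by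
  funext s; rcases s with i | (_ | _) <;> rfl

/-- The square of the interior norm. -/
theorem sobNorm_sq {φ : ℝ → ℝ} (hφ : Continuous φ) {u : ℝ × ℝ → ℝ} {G : ℝ × ℝ → Fin 2 → ℝ}
    (h : IsWeakGrad (region φ) u G) (g : ℝ × ℝ → ℝ) : sobNorm (region φ) u ^ 2 =
      ∑ i, eLpNorm (slotFun u G g (.inl i)) 2 (slotMeasure φ (.inl i)) ^ 2 +
        eLpNorm (slotFun u G g (.inr false)) 2 (slotMeasure φ (.inr false)) ^ 2 := by
  have hex : ∃ G, IsWeakGrad (region φ) u G := ⟨G, h⟩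
  rw [sobNorm, if_pos hex, ← ENNReal.rpow_natCast, ← ENNReal.rpow_mul]
  norm_num only [Nat.cast_ofNat, ENNReal.rpow_one]
  rw [add_comm]
  congr 1
  · simp only [sq_eLpNorm_two, slotFun, slotMeasure]
    have hm : ∀ i, AEMeasurable (fun X => ENNReal.ofReal (G X i ^ 2))
        (volume.restrict (region φ)) := fun i =>
      ((h.2.1 i).aestronglyMeasurable.aemeasurable.pow_const 2).ennreal_ofReal
    rw [← lintegral_finsetSum' _ fun i _ => hm i]
    refine lintegral_congr_ae ?_
    filter_upwards [h.weakGrad_ae_eq (isOpen_region hφ) 0,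
      h.weakGrad_ae_eq (isOpen_region hφ) 1] with X h0 h1
    rw [dotProduct, Fin.sum_univ_two, Fin.sum_univ_two, h0, h1,
      ← ENNReal.ofReal_add (sq_nonneg _) (sq_nonneg _), sq, sq]
  · simp only [sq_eLpNorm_two, slotFun, slotMeasure]
    rw [lintegral_withDensity_eq_lintegral_mul_non_measurable _ measurable_interiorWeight
      (ae_of_all _ fun _ => ENNReal.ofReal_lt_top)]
    refine lintegral_congr fun X => ?_
    have := euclSq_nonneg X
    rw [Pi.mul_apply, interiorWeight, ← ENNReal.ofReal_mul (by positivity)]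
    congr 1; ring

theorem bdryNorm_eq (φ : ℝ → ℝ) (g : ℝ × ℝ → ℝ) :
    bdryNorm φ g ^ 2 = eLpNorm g 2 (slotMeasure φ (.inr true)) ^ 2 := by
  rw [bdryNorm, ← ENNReal.rpow_natCast, ← ENNReal.rpow_mul, sq_eLpNorm_two]
  norm_num only [Nat.cast_ofNat, ENNReal.rpow_one]
  simp only [slotMeasure]
  rw [lintegral_withDensity_eq_lintegral_mul_non_measurable _ measurable_boundaryWeight
      (ae_of_all _ fun _ => ENNReal.ofReal_lt_top)]
  refine lintegral_congr fun X => ?_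
  rw [Pi.mul_apply, boundaryWeight, ← ENNReal.ofReal_mul (by positivity)]
  congr 1; ring

/-- This identity turns convergence in the ambient space into the two limits required by `HasTrace`,
and conversely. -/
theorem Represents.enorm_sq_eq {φ : ℝ → ℝ} (hφ : Continuous φ) {x : Ambient φ} {u g : ℝ × ℝ → ℝ}
    {G : ℝ × ℝ → Fin 2 → ℝ} (hx : Represents x (slotFun u G g)) (h : IsWeakGrad (region φ) u G) :
    ‖x‖ₑ ^ 2 = sobNorm (region φ) u ^ 2 + bdryNorm φ g ^ 2 := by
  rw [hx.enorm_sq, sobNorm_sq hφ h g, bdryNorm_eq, Fintype.sum_sum_type, Fintype.sum_bool]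
  simp only [slotFun]
  ring

theorem MemSob.isWeakGrad {Ω : Set (ℝ × ℝ)} {u : ℝ × ℝ → ℝ} (h : MemSob Ω u) :
    IsWeakGrad Ω u (weakGrad Ω u) := by
  by_cases hex : ∃ G, IsWeakGrad Ω u G
  · have : weakGrad Ω u = hex.choose := by simp [weakGrad, hex]
    rw [this]; exact hex.choose_spec
  · simp [MemSob, sobNorm, hex] at h

theorem lt_top_of_sq_lt_top {a : ℝ≥0∞} (h : a ^ 2 < ⊤) : a < ⊤ :=
  (ENNReal.pow_lt_top_iff.1 h).resolve_right two_ne_zero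

theorem exists_rep_slotFun {φ : ℝ → ℝ} (hφ : Continuous φ) {u g : ℝ × ℝ → ℝ}
    {G : ℝ × ℝ → Fin 2 → ℝ} (h : IsWeakGrad (region φ) u G) (hu : MemSob (region φ) u)
    (hg : AEStronglyMeasurable g (surf φ)) (hg' : bdryNorm φ g < ⊤) :
    ∃ x : Ambient φ, Represents x (slotFun u G g) := by
  have hu2 : sobNorm (region φ) u ^ 2 < ⊤ := ENNReal.pow_lt_top hu
  rw [sobNorm_sq hφ h g, ENNReal.add_lt_top, ENNReal.sum_lt_top] at hu2
  have hg2 : bdryNorm φ g ^ 2 < ⊤ := ENNReal.pow_lt_top hg'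
  rw [bdryNorm_eq] at hg2
  refine exists_rep fun s => ?_
  rcases s with i | (_ | _)
  · exact ⟨(h.2.1 i).aestronglyMeasurable,
      lt_top_of_sq_lt_top (hu2.1 i (Finset.mem_univ i))⟩
  · exact ⟨h.1.aestronglyMeasurable.mono_ac (withDensity_absolutelyContinuous _ _),
      lt_top_of_sq_lt_top hu2.2⟩
  · exact ⟨hg.mono_ac (withDensity_absolutelyContinuous _ _),
      lt_top_of_sq_lt_top hg2⟩

/-! ### The space of functions with their gradients and traces -/

/-- The families of smooth functions of finite norm. -/
def smoothPart (φ : ℝ → ℝ) : Submodule ℝ (Ambient φ) where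
  carrier := {x | ∃ ψ, ContDiff ℝ ∞ ψ ∧ Represents x (slotFun ψ (classGrad ψ) ψ)}
  zero_mem' := by
    refine ⟨0, contDiff_const, ?_⟩
    have : slotFun 0 (classGrad 0) 0 = 0 := by
      funext s X
      rcases s with i | (_ | _)
      · simp [slotFun, classGrad]
      · rfl
      · rfl
    rw [this]; exact Represents.zero
  add_mem' := by
    rintro x y ⟨ψ, hψ, hx⟩ ⟨χ, hχ, hy⟩
    refine ⟨ψ + χ, hψ.add hχ, ?_⟩
    have : classGrad (ψ + χ) = classGrad ψ + classGrad χ := by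
      funext X i
      simp only [classGrad, Pi.add_apply]
      rw [fderiv_add (hψ.differentiable (by simp) X) (hχ.differentiable (by simp) X)]
      rfl
    rw [this, slotFun_add]
    exact hx.add hy
  smul_mem' := by
    rintro r x ⟨ψ, hψ, hx⟩
    refine ⟨r • ψ, hψ.const_smul r, ?_⟩
    have : classGrad (r • ψ) = r • classGrad ψ := by
      funext X i
      simp only [classGrad, Pi.smul_apply]
      rw [fderiv_const_smul (hψ.differentiable (by simp) X)]
      rfl
    rw [this, slotFun_smul]
    exact hx.smul r

/-- The families of a function, its gradient and its trace. -/
def traceSpace (φ : ℝ → ℝ) : Submodule ℝ (Ambient φ) := (smoothPart φ).topologicalClosure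

/-- The integral is an inner product with a fixed `L²` class; it is used to show that integration by
parts is a closed condition. -/
theorem continuous_integral_mul {φ : ℝ → ℝ} (s : Fin 2 ⊕ Bool) {h : ℝ × ℝ → ℝ}
    (hh : MemLp h 2 (slotMeasure φ s)) :
    Continuous fun x : Ambient φ => ∫ X, x s X * h X ∂(slotMeasure φ s) := by
  have : (fun x : Ambient φ => ∫ X, x s X * h X ∂(slotMeasure φ s)) =
      fun x : Ambient φ => inner ℝ (hh.toLp h) (x s) := by
    funext x
    rw [L2.inner_def]
    refine integral_congr_ae ?_
    filter_upwards [hh.coeFn_toLp] with X hX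
    simp [hX]
  rw [this]
  exact continuous_const.inner (PiLp.continuous_apply 2 _ s)

theorem memLp_of_continuous_of_hasCompactSupport {μ : Measure (ℝ × ℝ)}
    [IsFiniteMeasureOnCompacts μ] {h : ℝ × ℝ → ℝ} (hc : Continuous h)
    (hs : HasCompactSupport h) : MemLp h 2 μ := hc.memLp_of_hasCompactSupport hs

theorem interior_le (φ : ℝ → ℝ) :
    slotMeasure φ (.inr false) ≤ volume.restrict (region φ) := by
  refine (withDensity_mono (ae_of_all _ fun X => ?_)).trans withDensity_one.le
  have := euclSq_nonneg X
  rw [interiorWeight, Pi.one_apply, ENNReal.ofReal_le_one, div_le_one (by positivity)]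
  linarith

theorem isFiniteMeasureOnCompacts_interior (φ : ℝ → ℝ) :
    IsFiniteMeasureOnCompacts (slotMeasure φ (.inr false)) := by
  refine ⟨fun K hK => ?_⟩
  exact (interior_le φ K).trans_lt ((Measure.restrict_le_self K).trans_lt hK.measure_lt_top)

/-- The test function absorbs the inverse of the weight, so that an unweighted pairing becomes
continuous on the weighted `L²` space. -/
theorem integral_interior {φ : ℝ → ℝ} (f h : ℝ × ℝ → ℝ) :
    ∫ X in region φ, f X * h X =
      ∫ X, f X * ((1 + euclSq X) * h X) ∂(slotMeasure φ (.inr false)) := by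
  simp only [slotMeasure]
  rw [integral_withDensity_eq_integral_toReal_smul measurable_interiorWeight
    (ae_of_all _ fun _ => ENNReal.ofReal_lt_top)]
  refine integral_congr_ae (ae_of_all _ fun X => ?_)
  have := euclSq_nonneg X
  simp only [interiorWeight]
  rw [ENNReal.toReal_ofReal (by positivity), smul_eq_mul]
  field_simp

theorem interior_ac (φ : ℝ → ℝ) :
    volume.restrict (region φ) ≪ slotMeasure φ (.inr false) :=
  withDensity_absolutelyContinuous' measurable_interiorWeight.aemeasurable
    (ae_of_all _ interiorWeight_ne_zero)

/-- The inverse weight `1 + |X|²` is continuous, hence bounded on compact sets. -/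
theorem locallyIntegrableOn_interior {φ : ℝ → ℝ} (hφ : Continuous φ) {u : ℝ × ℝ → ℝ}
    (hu : MemLp u 2 (slotMeasure φ (.inr false))) :
    LocallyIntegrableOn u (region φ) volume := by
  have hlc : LocallyIntegrable (fun X => u X) (slotMeasure φ (.inr false)) := by
    have := isFiniteMeasureOnCompacts_interior φ
    exact hu.locallyIntegrable (by norm_num)
  rw [locallyIntegrableOn_iff (isOpen_region hφ).isLocallyClosed]
  intro K hK hKc
  have h1 : IntegrableOn u K (slotMeasure φ (.inr false)) := hlc.integrableOn_isCompact hKc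
  simp only [slotMeasure] at h1
  rw [IntegrableOn, restrict_withDensity hKc.measurableSet,
    integrable_withDensity_iff_integrable_smul' measurable_interiorWeight
      (ae_of_all _ fun _ => ENNReal.ofReal_lt_top), Measure.restrict_restrict hKc.measurableSet,
    Set.inter_eq_left.2 hK] at h1
  have h2 : IntegrableOn (fun X => ((interiorWeight X).toReal • u X) * (1 + euclSq X)) K volume :=
    IntegrableOn.mul_continuousOn h1 (continuous_const.add continuous_euclSq).continuousOn hKc
  refine h2.congr (ae_of_all _ fun X => ?_)
  have := euclSq_nonneg X
  simp only [interiorWeight]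
  rw [ENNReal.toReal_ofReal (by positivity), smul_eq_mul]
  field_simp

theorem Represents.isWeakGrad {φ : ℝ → ℝ} (hφ : Continuous φ) {x : Ambient φ} (hx : x ∈ traceSpace φ)
    {u g : ℝ × ℝ → ℝ} {G : ℝ × ℝ → Fin 2 → ℝ} (h : Represents x (slotFun u G g)) :
    IsWeakGrad (region φ) u G := by
  have hΩ := isOpen_region hφ
  refine ⟨locallyIntegrableOn_interior hφ (h.memLp (.inr false)), fun i => ?_,
    fun ψ h1 h2 h3 i => ?_⟩
  · have h1 : MemLp (fun X => G X i) 2 (volume.restrict (region φ)) := h.memLp (.inl i)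
    exact locallyIntegrableOn_of_locallyIntegrable_restrict (h1.locallyIntegrable (by norm_num))
  -- Both sides are continuous in `y`, being pairings with fixed compactly supported functions. The
  -- identity holds for smooth families, hence on their closure.
  have hcl : IsClosed {y : Ambient φ |
      ∫ X, y (.inr false) X * ((1 + euclSq X) * fderiv ℝ ψ X (dir i)) ∂(slotMeasure φ (.inr false))
        = -∫ X, y (.inl i) X * ψ X ∂(slotMeasure φ (.inl i))} := by
    refine isClosed_eq (continuous_integral_mul _ ?_) (continuous_integral_mul _ ?_).neg
    · have := isFiniteMeasureOnCompacts_interior φ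
      refine memLp_of_continuous_of_hasCompactSupport
        ((continuous_const.add continuous_euclSq).mul (continuous_classGrad h1 i)) ?_
      exact (h2.fderiv_apply ℝ (dir i)).mul_left
    · have : IsFiniteMeasureOnCompacts (slotMeasure φ (.inl i)) := by
        simp only [slotMeasure]; infer_instance
      exact memLp_of_continuous_of_hasCompactSupport h1.continuous h2
  have hmem : x ∈ {y : Ambient φ |
      ∫ X, y (.inr false) X * ((1 + euclSq X) * fderiv ℝ ψ X (dir i)) ∂(slotMeasure φ (.inr false))
        = -∫ X, y (.inl i) X * ψ X ∂(slotMeasure φ (.inl i))} := by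
    refine closure_minimal ?_ hcl hx
    rintro y ⟨χ, hχ, hy⟩
    have e := (isWeakGrad_classGrad (region φ) hχ).2.2 ψ h1 h2 h3 i
    rw [integral_interior] at e
    refine (integral_congr_ae ?_).trans (e.trans (congrArg _ (integral_congr_ae ?_)))
    · exact (hy (.inr false)).mul (ae_eq_refl _)
    · exact ((hy (.inl i)).mul (ae_eq_refl _)).symm
  rw [integral_interior]
  refine (integral_congr_ae ?_).trans (Eq.trans hmem (congrArg _ (integral_congr_ae ?_)))
  · exact ((h (.inr false)).mul (ae_eq_refl _)).symm
  · exact (h (.inl i)).mul (ae_eq_refl _)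

theorem Represents.sobNorm_le {φ : ℝ → ℝ} (hφ : Continuous φ) {x : Ambient φ} (hx : x ∈ traceSpace φ)
    {u g : ℝ × ℝ → ℝ} {G : ℝ × ℝ → Fin 2 → ℝ} (h : Represents x (slotFun u G g)) :
    sobNorm (region φ) u ≤ ‖x‖ₑ := by
  rw [← ENNReal.pow_le_pow_left_iff two_ne_zero, h.enorm_sq_eq hφ (h.isWeakGrad hφ hx)]
  exact le_self_add

theorem Represents.memSob {φ : ℝ → ℝ} (hφ : Continuous φ) {x : Ambient φ} (hx : x ∈ traceSpace φ)
    {u g : ℝ × ℝ → ℝ} {G : ℝ × ℝ → Fin 2 → ℝ} (h : Represents x (slotFun u G g)) :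
    MemSob (region φ) u :=
  (h.sobNorm_le hφ hx).trans_lt enorm_lt_top

theorem tendsto_zero_of_sq {a : ℕ → ℝ≥0∞} (h : Tendsto (fun n => a n ^ 2) atTop (𝓝 0)) :
    Tendsto a atTop (𝓝 0) := by
  have h1 := h.ennrpow_const (1 / 2 : ℝ)
  rw [ENNReal.zero_rpow_of_pos (by norm_num)] at h1
  refine h1.congr fun n => ?_
  rw [← ENNReal.rpow_natCast, ← ENNReal.rpow_mul]
  norm_num

theorem Represents.hasTrace {φ : ℝ → ℝ} (hφ : Continuous φ) {x : Ambient φ} (hx : x ∈ traceSpace φ)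
    {u g : ℝ × ℝ → ℝ} {G : ℝ × ℝ → Fin 2 → ℝ} (h : Represents x (slotFun u G g)) :
    HasTrace φ u g := by
  obtain ⟨X, hX, hlim⟩ := mem_closure_iff_seq_limit.1 hx
  choose ψ hψ hrep using hX
  have hsub : ∀ n, Represents (X n - x) (slotFun (ψ n - u) (classGrad (ψ n) - G) (ψ n - g)) := fun n => by
    rw [slotFun_sub]; exact (hrep n).sub h
  have hgr : ∀ n, IsWeakGrad (region φ) (ψ n - u) (classGrad (ψ n) - G) := fun n =>
    (isWeakGrad_classGrad _ (hψ n)).sub (h.isWeakGrad hφ hx)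
  have h0 : Tendsto (fun n => ‖X n - x‖ₑ ^ 2) atTop (𝓝 0) := by
    have h1 : Tendsto (fun n => ‖X n - x‖ₑ) atTop (𝓝 0) := by
      have := (hlim.sub_const x).enorm
      rwa [sub_self, enorm_zero] at this
    simpa using ENNReal.Tendsto.pow (n := 2) h1
  refine ⟨ψ, fun n => ⟨hψ n, (hrep n).memSob hφ (Submodule.le_topologicalClosure _
    ⟨ψ n, hψ n, hrep n⟩)⟩, tendsto_zero_of_sq ?_, tendsto_zero_of_sq ?_⟩
  · refine tendsto_of_tendsto_of_tendsto_of_le_of_le tendsto_const_nhds h0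
      (fun _ => zero_le) fun n => ?_
    simp only [(hsub n).enorm_sq_eq hφ (hgr n)]
    exact le_self_add
  · refine tendsto_of_tendsto_of_tendsto_of_le_of_le tendsto_const_nhds h0
      (fun _ => zero_le) fun n => ?_
    simp only [(hsub n).enorm_sq_eq hφ (hgr n)]
    exact le_add_self

/-- Converse of `Represents.hasTrace`: the approximating functions, with their gradients and
boundary values, converge to the family in the ambient norm. -/
theorem exists_mem_traceSpace {φ : ℝ → ℝ} (hφ : Continuous φ) {u g : ℝ × ℝ → ℝ}
    (hu : MemSob (region φ) u) (ht : HasTrace φ u g) (hg : AEStronglyMeasurable g (surf φ))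
    (hg' : bdryNorm φ g < ⊤) :
    ∃ x ∈ traceSpace φ, Represents x (slotFun u (weakGrad (region φ) u) g) := by
  obtain ⟨x, hx⟩ := exists_rep_slotFun hφ hu.isWeakGrad hu hg hg'
  refine ⟨x, ?_, hx⟩
  obtain ⟨ψ, hψ, h1, h2⟩ := ht
  have hgr : ∀ n, IsWeakGrad (region φ) (ψ n - u) (classGrad (ψ n) - weakGrad (region φ) u) :=
    fun n => (isWeakGrad_classGrad _ (hψ n).1).sub hu.isWeakGrad
  change x ∈ closure (smoothPart φ : Set (Ambient φ))
  rw [EMetric.mem_closure_iff]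
  intro ε hε
  have hs : Tendsto (fun n => sobNorm (region φ) (ψ n - u) ^ 2 + bdryNorm φ (ψ n - g) ^ 2)
      atTop (𝓝 0) := by
    simpa using (ENNReal.Tendsto.pow (n := 2) h1).add (ENNReal.Tendsto.pow (n := 2) h2)
  have e1 := hs.eventually_lt_const (u := ε ^ 2) (by positivity)
  have e2 := h1.eventually_lt_const ENNReal.zero_lt_top
  have e3 := h2.eventually_lt_const ENNReal.zero_lt_top
  obtain ⟨n, hn1, hn2, hn3⟩ := (e1.and (e2.and e3)).exists
  -- Only the difference `ψ n - u` is known to have finite norm in the required form; adding its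
  -- class `y` to `x` produces the class of `ψ n`.
  obtain ⟨y, hy⟩ := exists_rep_slotFun hφ (hgr n) hn2
    ((hψ n).1.continuous.aestronglyMeasurable.sub hg) hn3
  have hxy : Represents (x + y) (slotFun (ψ n) (classGrad (ψ n)) (ψ n)) := by
    have := hx.add hy
    rw [← slotFun_add] at this
    simpa using this
  refine ⟨x + y, ⟨ψ n, (hψ n).1, hxy⟩, ?_⟩
  rw [← ENNReal.pow_lt_pow_left_iff two_ne_zero, edist_comm, edist_eq_enorm_sub,
    add_sub_cancel_left, hy.enorm_sq_eq hφ (hgr n)]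
  exact hn1

/-! ### Hardy's inequality -/

/-- With `s = a + t - c`, the derivative of `-2f²/s` is `2f²/s² - 4ff'/s`. Adding `4f'²` and
subtracting `f²/s²` leaves the square `(f/s - 2f')²`. The boundary term at `T` has a favourable sign
and is dropped, so no decay at infinity is needed. -/
theorem intervalIntegral_hardy {f : ℝ → ℝ} (hf : ContDiff ℝ 1 f) {a c T : ℝ} (ha : 0 < a)
    (hT : c ≤ T) : ∫ t in c..T, f t ^ 2 / (a + t - c) ^ 2 ≤
      2 * f c ^ 2 / a + ∫ t in c..T, 4 * deriv f t ^ 2 := by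
  have hpos : ∀ t ∈ Set.Icc c T, 0 < a + t - c := fun t ht => by linarith [ht.1]
  have hd : Continuous (deriv f) := hf.continuous_deriv le_rfl
  have hder : ∀ t ∈ Set.uIcc c T, HasDerivAt (fun t => -(2 * f t ^ 2 / (a + t - c)))
      (2 * f t ^ 2 / (a + t - c) ^ 2 - 4 * (f t * deriv f t) / (a + t - c)) t := by
    intro t ht
    rw [Set.uIcc_of_le hT] at ht
    have h1 : HasDerivAt f (deriv f t) t := (hf.differentiable one_ne_zero t).hasDerivAt
    have h2 : HasDerivAt (fun t => a + t - c) 1 t :=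
      ((hasDerivAt_id t).const_add a).sub_const c
    have h3 := (((h1.pow 2).const_mul 2).div h2 (hpos t ht).ne').neg
    refine h3.congr_deriv ?_
    have := (hpos t ht).ne'
    simp only [Pi.pow_apply]
    field_simp
    ring
  have hb : ContinuousOn (fun t => a + t - c) (Set.uIcc c T) := by fun_prop
  have hb0 : ∀ t ∈ Set.uIcc c T, a + t - c ≠ 0 := fun t ht => by
    rw [Set.uIcc_of_le hT] at ht; exact (hpos t ht).ne'
  have hfc := hf.continuous
  have hi1 : IntervalIntegrable (fun t => f t ^ 2 / (a + t - c) ^ 2) volume c T :=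
    ((hfc.pow 2).continuousOn.div (hb.pow 2) fun t ht => pow_ne_zero 2
      (hb0 t ht)).intervalIntegrable
  have hi2 : IntervalIntegrable
      (fun t => 2 * f t ^ 2 / (a + t - c) ^ 2 - 4 * (f t * deriv f t) / (a + t - c)) volume c T :=
    ((((hfc.pow 2).const_mul 2).continuousOn.div (hb.pow 2) fun t ht => pow_ne_zero 2
      (hb0 t ht)).sub (((hfc.mul hd).const_mul 4).continuousOn.div hb hb0)).intervalIntegrable
  have hi3 : IntervalIntegrable (fun t => 4 * deriv f t ^ 2) volume c T :=
    ((hd.pow 2).const_mul 4).intervalIntegrable _ _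
  calc ∫ t in c..T, f t ^ 2 / (a + t - c) ^ 2
      ≤ ∫ t in c..T, ((2 * f t ^ 2 / (a + t - c) ^ 2 - 4 * (f t * deriv f t) / (a + t - c)) +
          4 * deriv f t ^ 2) := by
        refine intervalIntegral.integral_mono_on hT hi1 (hi2.add hi3) fun t ht => ?_
        have hp := (hpos t ht).ne'
        have : (2 * f t ^ 2 / (a + t - c) ^ 2 - 4 * (f t * deriv f t) / (a + t - c)) +
          4 * deriv f t ^ 2 - f t ^ 2 / (a + t - c) ^ 2 =
            (f t / (a + t - c) - 2 * deriv f t) ^ 2 := by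
          field_simp; ring
        nlinarith [sq_nonneg (f t / (a + t - c) - 2 * deriv f t)]
    _ = -(2 * f T ^ 2 / (a + T - c)) + 2 * f c ^ 2 / a + ∫ t in c..T, 4 * deriv f t ^ 2 := by
        rw [intervalIntegral.integral_add hi2 hi3,
          intervalIntegral.integral_eq_sub_of_hasDerivAt hder hi2]
        simp only [add_sub_cancel_right]
        ring
    _ ≤ _ := by
        have := hpos T ⟨hT, le_rfl⟩
        have : 0 ≤ 2 * f T ^ 2 / (a + T - c) := by positivity
        linarith

theorem lintegral_hardy {f : ℝ → ℝ} (hf : ContDiff ℝ 1 f) {a : ℝ} (c : ℝ) (ha : 0 < a) :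
    ∫⁻ t in Set.Ioi c, ENNReal.ofReal (f t ^ 2 / (a + t - c) ^ 2) ≤
      ENNReal.ofReal (2 * f c ^ 2 / a) +
        ∫⁻ t in Set.Ioi c, ENNReal.ofReal (4 * deriv f t ^ 2) := by
  have hU : Set.Ioi c = ⋃ n : ℕ, Set.Ioc c (c + n) := by
    ext t
    simp only [Set.mem_Ioi, Set.mem_iUnion, Set.mem_Ioc, exists_and_left]
    refine ⟨fun h => ⟨h, ?_⟩, fun h => h.1⟩
    obtain ⟨n, hn⟩ := exists_nat_ge (t - c)
    exact ⟨n, by linarith⟩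
  have hd : Continuous (deriv f) := hf.continuous_deriv le_rfl
  conv_lhs => rw [hU]
  rw [setLIntegral_iUnion_of_directed]
  swap
  · refine Monotone.directed_le fun n m hnm => Set.Ioc_subset_Ioc_right ?_
    have : (n : ℝ) ≤ m := by exact_mod_cast hnm
    linarith
  refine iSup_le fun n => ?_
  have hT : c ≤ c + n := by linarith [(Nat.cast_nonneg n : (0 : ℝ) ≤ n)]
  have hi : IntervalIntegrable (fun t => f t ^ 2 / (a + t - c) ^ 2) volume c (c + n) := by
    refine ((hf.continuous.pow 2).continuousOn.div (by fun_prop) fun t ht => ?_).intervalIntegrable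
    rw [Set.uIcc_of_le hT] at ht
    have : 0 < a + t - c := by linarith [ht.1]
    positivity
  have hi3 : IntervalIntegrable (fun t => 4 * deriv f t ^ 2) volume c (c + n) :=
    ((hd.pow 2).const_mul 4).intervalIntegrable _ _
  have h := intervalIntegral_hardy hf ha hT
  rw [intervalIntegral.integral_of_le hT, intervalIntegral.integral_of_le hT] at h
  rw [← ofReal_integral_eq_lintegral_ofReal hi.1 (ae_of_all _ fun t => by positivity)]
  refine (ENNReal.ofReal_le_ofReal h).trans (ENNReal.ofReal_add_le.trans ?_)
  gcongr
  rw [ofReal_integral_eq_lintegral_ofReal hi3.1 (ae_of_all _ fun t => by positivity)]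
  exact lintegral_mono_set Set.Ioc_subset_Ioi_self

/-! ### Integrals over the domain and along the graph. -/

theorem setLIntegral_region {φ : ℝ → ℝ} (hφ : Continuous φ) {F : ℝ × ℝ → ℝ≥0∞}
    (hF : Measurable F) :
    ∫⁻ X in region φ, F X = ∫⁻ x, ∫⁻ t in Set.Ioi (φ x), F (x, t) := by
  have hm := (isOpen_region hφ).measurableSet
  rw [← lintegral_indicator hm, Measure.volume_eq_prod,
    lintegral_prod _ (hF.indicator hm).aemeasurable]
  refine lintegral_congr fun x => ?_
  rw [← lintegral_indicator measurableSet_Ioi]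
  rfl

theorem measurable_surfDensity (φ : ℝ → ℝ) :
    Measurable fun x => ENNReal.ofReal (√(1 + deriv φ x ^ 2)) := by
  have := measurable_deriv φ
  fun_prop

theorem lintegral_surf {φ : ℝ → ℝ} (hφ : Continuous φ) {g : ℝ × ℝ → ℝ≥0∞}
    (hg : AEMeasurable g (surf φ)) : ∫⁻ X, g X ∂(surf φ) =
      ∫⁻ x, ENNReal.ofReal (√(1 + deriv φ x ^ 2)) * g (x, φ x) := by
  have hm : Measurable fun x => (x, φ x) := by fun_prop
  rw [surf, lintegral_map' hg hm.aemeasurable]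
  exact lintegral_withDensity_eq_lintegral_mul_non_measurable _ (measurable_surfDensity φ)
    (ae_of_all _ fun _ => ENNReal.ofReal_lt_top) _

theorem one_le_sqrt_one_add_sq (r : ℝ) : 1 ≤ √(1 + r ^ 2) := by
  rw [Real.one_le_sqrt]
  linarith [sq_nonneg r]

theorem lintegral_graph_le_surf {φ : ℝ → ℝ} (hφ : Continuous φ) {g : ℝ × ℝ → ℝ≥0∞}
    (hg : AEMeasurable g (surf φ)) : ∫⁻ x, g (x, φ x) ≤ ∫⁻ X, g X ∂(surf φ) := by
  rw [lintegral_surf hφ hg]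
  exact lintegral_mono fun x => le_mul_of_one_le_left zero_le
    (ENNReal.one_le_ofReal.2 (one_le_sqrt_one_add_sq _))

theorem abs_le_of_lipschitz {φ : ℝ → ℝ} {K : ℝ≥0} (hφ : LipschitzWith K φ) (x : ℝ) :
    |φ x| ≤ |φ 0| + K * |x| := by
  have h := hφ.dist_le_mul x 0
  rw [Real.dist_eq, Real.dist_eq, sub_zero] at h
  have := abs_sub_abs_le_abs_sub (φ x) (φ 0)
  linarith

/-- Compares the interior weight with the Hardy weight started at `a = 1 + |(x, φ x)|`. The
Lipschitz bound gives `a + t - φ x ≤ m (1 + |x| + |t|)`, and `(1 + |x| + |t|)² ≤ 3 (1 + x² + t²)`.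
-/
theorem weight_le {φ : ℝ → ℝ} {K : ℝ≥0} (hφ : LipschitzWith K φ) {x t : ℝ} (ht : φ x < t) :
    1 / (1 + euclSq (x, t)) ≤ 3 * (1 + 2 * |φ 0| + 2 * K) ^ 2 *
      (1 / (1 + √(euclSq (x, φ x)) + t - φ x) ^ 2) := by
  have hs : √(euclSq (x, φ x)) ≤ |x| + |φ x| := by
    rw [← abs_of_nonneg (add_nonneg (abs_nonneg x) (abs_nonneg (φ x))), ← Real.sqrt_sq_eq_abs]
    refine Real.sqrt_le_sqrt ?_
    rw [euclSq, add_sq, sq_abs, sq_abs]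
    have : 0 ≤ |x| * |φ x| := by positivity
    simp only
    linarith
  have h1 := abs_le_of_lipschitz hφ x
  have hs0 := Real.sqrt_nonneg (euclSq (x, φ x))
  have hK : (0 : ℝ) ≤ K := K.2
  have h0 := abs_nonneg (φ 0)
  have hb0 : 0 < 1 + √(euclSq (x, φ x)) + t - φ x := by linarith
  set m := 1 + 2 * |φ 0| + 2 * (K : ℝ) with hm
  have hb : 1 + √(euclSq (x, φ x)) + t - φ x ≤ m * (1 + |x| + |t|) := by
    have e1 := le_abs_self t
    have e2 := neg_abs_le (φ x)
    have : 0 ≤ (2 * |φ 0| + 2 * K) * |t| + 2 * |φ 0| * |x| + 2 * K := by positivity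
    rw [hm]
    nlinarith
  have h3 : (1 + |x| + |t|) ^ 2 ≤ 3 * (1 + euclSq (x, t)) := by
    rw [euclSq, ← sq_abs x, ← sq_abs t]
    nlinarith [sq_nonneg (|x| - |t|), sq_nonneg (|x| - 1), sq_nonneg (|t| - 1)]
  have hsq : (1 + √(euclSq (x, φ x)) + t - φ x) ^ 2 ≤ 3 * m ^ 2 * (1 + euclSq (x, t)) := by
    calc _ ≤ (m * (1 + |x| + |t|)) ^ 2 := pow_le_pow_left₀ hb0.le hb 2
      _ = m ^ 2 * (1 + |x| + |t|) ^ 2 := by ring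
      _ ≤ m ^ 2 * (3 * (1 + euclSq (x, t))) := by gcongr
      _ = _ := by ring
  have := euclSq_nonneg (x, t)
  rw [mul_one_div, div_le_div_iff₀ (by positivity) (by positivity)]
  linarith

/-- Hardy's inequality on the half-line above `(x, φ x)` with `a = 1 + |(x, φ x)|`, integrated in
`x`. This choice of `a` makes the boundary term carry the weight of the trace norm, and arc length
dominates `dx`. -/
theorem lintegral_interior_le {φ : ℝ → ℝ} {K : ℝ≥0} (hφ : LipschitzWith K φ) {ψ : ℝ × ℝ → ℝ}
    (hψ : ContDiff ℝ ∞ ψ) :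
    eLpNorm ψ 2 (slotMeasure φ (.inr false)) ^ 2 ≤
      ENNReal.ofReal (3 * (1 + 2 * |φ 0| + 2 * K) ^ 2) *
        (4 * eLpNorm (fun X => classGrad ψ X 1) 2 (slotMeasure φ (.inl 1)) ^ 2 +
          2 * eLpNorm ψ 2 (slotMeasure φ (.inr true)) ^ 2) := by
  have hc := hφ.continuous
  have hψc := hψ.continuous
  have hψm : Measurable ψ := hψc.measurable
  have hgm : Measurable fun X => classGrad ψ X 1 := (continuous_classGrad hψ 1).measurable
  have hφm : Measurable φ := hc.measurable
  have he : Measurable euclSq := continuous_euclSq.measurable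
  simp only [sq_eLpNorm_two]
  set M := 3 * (1 + 2 * |φ 0| + 2 * (K : ℝ)) ^ 2 with hM
  have hbd : 2 * ∫⁻ X, ENNReal.ofReal (ψ X ^ 2) ∂(slotMeasure φ (.inr true)) ≥
      ∫⁻ x, ENNReal.ofReal (2 * ψ (x, φ x) ^ 2 / (1 + √(euclSq (x, φ x)))) := by
    simp only [slotMeasure]
    rw [lintegral_withDensity_eq_lintegral_mul _ measurable_boundaryWeight (by fun_prop),
      ← lintegral_const_mul _ (by have := measurable_boundaryWeight; fun_prop)]
    refine le_trans (le_of_eq ?_) (lintegral_graph_le_surf hc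
      (by have := measurable_boundaryWeight; fun_prop))
    refine lintegral_congr fun x => ?_
    rw [Pi.mul_apply, boundaryWeight, ← ENNReal.ofReal_mul (by positivity),
      show (2 : ℝ≥0∞) = ENNReal.ofReal 2 by simp, ← ENNReal.ofReal_mul (by positivity)]
    congr 1; ring
  have hgr : 4 * ∫⁻ X, ENNReal.ofReal (classGrad ψ X 1 ^ 2) ∂(slotMeasure φ (.inl 1)) =
      ∫⁻ x, ∫⁻ t in Set.Ioi (φ x), ENNReal.ofReal (4 * deriv (fun t => ψ (x, t)) t ^ 2) := by
    simp only [slotMeasure]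
    rw [← lintegral_const_mul _ (by fun_prop), setLIntegral_region hc (by fun_prop)]
    refine lintegral_congr fun x => lintegral_congr fun t => ?_
    rw [← classGrad_one hψ, ENNReal.ofReal_mul (by norm_num)]
    simp
  have hint : ∫⁻ X, ENNReal.ofReal (ψ X ^ 2) ∂(slotMeasure φ (.inr false)) ≤
      ENNReal.ofReal M * ∫⁻ x, ∫⁻ t in Set.Ioi (φ x),
        ENNReal.ofReal (ψ (x, t) ^ 2 / (1 + √(euclSq (x, φ x)) + t - φ x) ^ 2) := by
    simp only [slotMeasure]
    have hm : Measurable fun X : ℝ × ℝ =>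
      ENNReal.ofReal (ψ X ^ 2 / (1 + √(euclSq (X.1, φ X.1)) + X.2 - φ X.1) ^ 2) := by fun_prop
    rw [lintegral_withDensity_eq_lintegral_mul _ measurable_interiorWeight (by fun_prop),
      ← setLIntegral_region hc hm, ← lintegral_const_mul _ hm]
    refine setLIntegral_mono (by fun_prop) fun X hX => ?_
    have h := weight_le hφ (x := X.1) (t := X.2) hX
    have := euclSq_nonneg X
    rw [Pi.mul_apply, interiorWeight, ← ENNReal.ofReal_mul (by positivity),
      ← ENNReal.ofReal_mul (by positivity)]
    refine ENNReal.ofReal_le_ofReal ?_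
    calc _ ≤ (M * (1 / (1 + √(euclSq (X.1, φ X.1)) + X.2 - φ X.1) ^ 2)) * ψ X ^ 2 := by
          gcongr
      _ = _ := by ring
  refine hint.trans ?_
  gcongr
  rw [hgr, add_comm]
  refine le_trans ?_ (add_le_add_left hbd _)
  rw [← lintegral_add_left (by fun_prop)]
  refine lintegral_mono fun x => ?_
  have hf : ContDiff ℝ 1 fun t => ψ (x, t) :=
    (hψ.of_le (by exact_mod_cast le_top)).comp (contDiff_const.prodMk contDiff_id)
  exact lintegral_hardy hf (φ x) (by positivity)

/-- The gradient and the trace control the function. -/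
theorem norm_interior_le {φ : ℝ → ℝ} {K : ℝ≥0} (hφ : LipschitzWith K φ) {x : Ambient φ}
    (hx : x ∈ traceSpace φ) :
    ‖x (.inr false)‖ ^ 2 ≤ 3 * (1 + 2 * |φ 0| + 2 * K) ^ 2 *
      (4 * ‖x (.inl 1)‖ ^ 2 + 2 * ‖x (.inr true)‖ ^ 2) := by
  have hcont : ∀ s, Continuous fun x : Ambient φ => x s := fun s => PiLp.continuous_apply 2 _ s
  -- Both sides are continuous in the ambient norm, so it suffices to treat smooth families.
  have hcl : IsClosed {x : Ambient φ | ‖x (.inr false)‖ ^ 2 ≤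
      3 * (1 + 2 * |φ 0| + 2 * K) ^ 2 * (4 * ‖x (.inl 1)‖ ^ 2 + 2 * ‖x (.inr true)‖ ^ 2)} :=
    isClosed_le ((hcont _).norm.pow 2)
      (((((hcont _).norm.pow 2).const_mul 4).add (((hcont _).norm.pow 2).const_mul 2)).const_mul _)
  refine closure_minimal ?_ hcl hx
  rintro y ⟨ψ, hψ, hy⟩
  have h := lintegral_interior_le hφ hψ
  have e : ∀ s, eLpNorm (slotFun ψ (classGrad ψ) ψ s) 2 (slotMeasure φ s) ^ 2 =
      ENNReal.ofReal (‖y s‖ ^ 2) := fun s => by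
    rw [ENNReal.ofReal_pow (norm_nonneg _), ofReal_norm, Lp.enorm_def, eLpNorm_congr_ae (hy s)]
  have e1 := e (.inl 1)
  have e2 := e (.inr false)
  have e3 := e (.inr true)
  simp only [slotFun] at e1 e2 e3
  rw [e1, e2, e3] at h
  have p1 := norm_nonneg (y (.inl 1))
  have p2 := norm_nonneg (y (.inr true))
  change ‖y (.inr false)‖ ^ 2 ≤
    3 * (1 + 2 * |φ 0| + 2 * K) ^ 2 * (4 * ‖y (.inl 1)‖ ^ 2 + 2 * ‖y (.inr true)‖ ^ 2)
  generalize ‖y (.inl 1)‖ = a, ‖y (.inr true)‖ = b, ‖y (.inr false)‖ = c at h p1 p2 ⊢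
  rw [show (4 : ℝ≥0∞) = ENNReal.ofReal 4 by simp,
    show (2 : ℝ≥0∞) = ENNReal.ofReal 2 by simp, ← ENNReal.ofReal_mul (by norm_num),
    ← ENNReal.ofReal_mul (by norm_num), ← ENNReal.ofReal_add (by positivity) (by positivity),
    ← ENNReal.ofReal_mul (by positivity), ENNReal.ofReal_le_ofReal_iff (by positivity)] at h
  exact h

/-! ### Mollification on the line -/

/-- Translations act continuously on `L²`. -/
theorem tendsto_eLpNorm_translate {f : ℝ → ℝ} (hf : MemLp f 2 volume) :
    Tendsto (fun y : ℝ => eLpNorm (fun x => f (x - y) - f x) 2 volume) (𝓝 0) (𝓝 0) := by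
  have : Fact ((2 : ℝ≥0∞) ≠ ⊤) := ⟨by simp⟩
  set F := hf.toLp f
  have hc : Continuous fun y : ℝ => DomAddAct.mk (-y) +ᵥ F :=
    (DomAddAct.continuous_mk.comp continuous_neg).vadd continuous_const
  have h1 : Tendsto (fun y : ℝ => ‖(DomAddAct.mk (-y) +ᵥ F) - F‖ₑ) (𝓝 0) (𝓝 0) := by
    have := (hc.sub continuous_const).enorm.tendsto (x := (0 : ℝ)) (f := fun y : ℝ =>
      ‖(DomAddAct.mk (-y) +ᵥ F) - F‖ₑ)
    simpa using this
  refine h1.congr fun y => ?_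
  rw [Lp.enorm_def]
  refine eLpNorm_congr_ae ?_
  have e1 : (fun x => F (-y +ᵥ x)) =ᵐ[volume] fun x => f (-y +ᵥ x) :=
    (measurePreserving_vadd (-y) (volume : Measure ℝ)).quasiMeasurePreserving.ae_eq_comp
      hf.coeFn_toLp
  filter_upwards [Lp.coeFn_sub (DomAddAct.mk (-y) +ᵥ F) F, DomAddAct.vadd_Lp_ae_eq
    (DomAddAct.mk (-y)) F, hf.coeFn_toLp, e1] with x h1 h2 h3 h4
  rw [h1, Pi.sub_apply, h2, h3]
  simp only [Equiv.symm_apply_apply] at h4 ⊢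
  rw [h4, vadd_eq_add, neg_add_eq_sub]

open scoped Convolution

/-- The mollification of `f` by a bump function. -/
def mollify (b : ContDiffBump (0 : ℝ)) (f : ℝ → ℝ) : ℝ → ℝ :=
  b.normed volume ⋆[ContinuousLinearMap.lsmul ℝ ℝ, volume] f

theorem mollify_apply (b : ContDiffBump (0 : ℝ)) (f : ℝ → ℝ) (x : ℝ) :
    mollify b f x = ∫ y, b.normed volume y * f (x - y) := by
  simp [mollify, convolution_lsmul]

theorem contDiff_mollify (b : ContDiffBump (0 : ℝ)) {f : ℝ → ℝ} (hf : LocallyIntegrable f) :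
    ContDiff ℝ ∞ (mollify b f) :=
  HasCompactSupport.contDiff_convolution_left _ b.hasCompactSupport_normed b.contDiff_normed hf

theorem integrable_normed_mul (b : ContDiffBump (0 : ℝ)) {f : ℝ → ℝ} (hf : LocallyIntegrable f)
    (x : ℝ) : Integrable fun y => b.normed volume y * f (x - y) :=
  HasCompactSupport.convolutionExists_left (ContinuousLinearMap.lsmul ℝ ℝ)
    b.hasCompactSupport_normed b.continuous_normed hf x

theorem mollify_sub_apply (b : ContDiffBump (0 : ℝ)) {f : ℝ → ℝ} (hf : LocallyIntegrable f)
    (x c : ℝ) : mollify b f x - c = ∫ y, b.normed volume y * (f (x - y) - c) := by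
  have h1 : ∫ y, b.normed volume y * c = c := by
    rw [integral_mul_const, b.integral_normed, one_mul]
  simp only [mul_sub]
  rw [integral_sub (integrable_normed_mul b hf x) (b.integrable_normed.mul_const c), h1,
    mollify_apply]

/-- `mollify b f - f` is an average of the differences `f(· - y) - f` over the probability measure
with density `b.normed`. The square of an average is at most the average of the squares, and Tonelli
exchanges the integrals. -/
theorem eLpNorm_mollify_sub_le (b : ContDiffBump (0 : ℝ)) {f : ℝ → ℝ} (hm : Measurable f)
    (hf : MemLp f 2 volume) {ε : ℝ≥0∞}
    (hε : ∀ y, |y| < b.rOut → eLpNorm (fun x => f (x - y) - f x) 2 volume ≤ ε) :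
    eLpNorm (mollify b f - f) 2 volume ≤ ε := by
  have hl : LocallyIntegrable f := hf.locallyIntegrable (by norm_num)
  have hρ : Measurable fun y => ENNReal.ofReal (b.normed volume y) :=
    b.continuous_normed.measurable.ennreal_ofReal
  have htop : ∀ᵐ y : ℝ, ENNReal.ofReal (b.normed volume y) < ⊤ :=
    ae_of_all _ fun y => ENNReal.ofReal_lt_top
  set m := (volume : Measure ℝ).withDensity fun y => ENNReal.ofReal (b.normed volume y) with hmdef
  have hint : ∫⁻ y, ENNReal.ofReal (b.normed volume y) = 1 := by
    rw [← ofReal_integral_eq_lintegral_ofReal b.integrable_normed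
      (ae_of_all _ fun y => b.nonneg_normed y), b.integral_normed, ENNReal.ofReal_one]
  have hprob : IsProbabilityMeasure m := ⟨by
    rw [hmdef, withDensity_apply _ MeasurableSet.univ, setLIntegral_univ, hint]⟩
  have hpt : ∀ x, ENNReal.ofReal ((mollify b f - f) x ^ 2) ≤
      ∫⁻ y, ENNReal.ofReal ((f (x - y) - f x) ^ 2) ∂m := by
    intro x
    have e1 : (mollify b f - f) x = ∫ y, (f (x - y) - f x) ∂m := by
      rw [Pi.sub_apply, mollify_sub_apply b hl, hmdef,
        integral_withDensity_eq_integral_toReal_smul hρ htop]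
      refine integral_congr_ae (ae_of_all _ fun y => ?_)
      simp only [smul_eq_mul]
      rw [ENNReal.toReal_ofReal (b.nonneg_normed y)]
    have e2 : ENNReal.ofReal ((mollify b f - f) x ^ 2) = ‖∫ y, (f (x - y) - f x) ∂m‖ₑ ^ 2 := by
      rw [e1, ← sq_abs, ENNReal.ofReal_pow (abs_nonneg _), ← Real.norm_eq_abs, ofReal_norm]
    rw [e2, ← sq_eLpNorm_two]
    gcongr
    refine (enorm_integral_le_lintegral_enorm _).trans ?_
    rw [← eLpNorm_one_eq_lintegral_enorm]
    exact eLpNorm_le_eLpNorm_of_exponent_le (by norm_num)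
      (by fun_prop : Measurable fun y => f (x - y) - f x).aestronglyMeasurable
  rw [← ENNReal.pow_le_pow_left_iff two_ne_zero, sq_eLpNorm_two]
  calc ∫⁻ x, ENNReal.ofReal ((mollify b f - f) x ^ 2)
      ≤ ∫⁻ x, ∫⁻ y, ENNReal.ofReal ((f (x - y) - f x) ^ 2) ∂m := lintegral_mono hpt
    _ = ∫⁻ y, (∫⁻ x, ENNReal.ofReal ((f (x - y) - f x) ^ 2)) ∂m :=
        lintegral_lintegral_swap (by
          refine Measurable.aemeasurable ?_
          unfold Function.uncurry
          fun_prop)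
    _ = ∫⁻ y, ENNReal.ofReal (b.normed volume y) *
          ∫⁻ x, ENNReal.ofReal ((f (x - y) - f x) ^ 2) := by
        rw [hmdef, lintegral_withDensity_eq_lintegral_mul_non_measurable _ hρ htop]
        rfl
    _ ≤ ∫⁻ y, ENNReal.ofReal (b.normed volume y) * ε ^ 2 := by
        refine lintegral_mono fun y => ?_
        by_cases hy : |y| < b.rOut
        · gcongr
          rw [← sq_eLpNorm_two]
          gcongr
          exact hε y hy
        -- Translations longer than the outer radius carry no mass.
        · have : b.normed volume y = 0 := by
            rw [← Function.notMem_support, b.support_normed_eq]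
            simpa using hy
          simp [this]
    _ = ε ^ 2 := by rw [lintegral_mul_const _ hρ, hint, one_mul]

/-- The reflected kernel `s ↦ b(x - s)` serves as test function; the sign from the reflection
cancels that of the integration by parts. -/
theorem deriv_mollify (b : ContDiffBump (0 : ℝ)) {f k : ℝ → ℝ} (hf : LocallyIntegrable f)
    (h : ∀ α : ℝ → ℝ, ContDiff ℝ ∞ α → HasCompactSupport α →
      ∫ x, f x * deriv α x = -∫ x, k x * α x) : deriv (mollify b f) = mollify b k := by
  funext x
  have h1 := (b.hasCompactSupport_normed (μ := volume)).hasDerivAt_convolution_left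
    (ContinuousLinearMap.lsmul ℝ ℝ) (μ := volume) (b.contDiff_normed (n := 1)) hf x
  have h2 : deriv (mollify b f) x = _ := h1.deriv
  rw [h2, mollify, convolution_eq_swap, convolution_eq_swap]
  have hα : ContDiff ℝ ∞ fun s => b.normed volume (x - s) :=
    b.contDiff_normed.comp (contDiff_const.sub contDiff_id)
  have hs : HasCompactSupport fun s => b.normed volume (x - s) :=
    (b.hasCompactSupport_normed (μ := volume)).comp_homeomorph (Homeomorph.subLeft x)
  have e := h _ hα hs
  simp only [deriv_comp_const_sub, mul_neg, integral_neg, neg_inj] at e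
  simpa [mul_comm] using e

theorem mollify_congr (b : ContDiffBump (0 : ℝ)) {f g : ℝ → ℝ} (h : f =ᵐ[volume] g) :
    mollify b f = mollify b g :=
  convolution_congr _ (ae_eq_refl _) h

/-- A shrinking family of bump functions. -/
def shrinkingBump (n : ℕ) : ContDiffBump (0 : ℝ) where
  rIn := 1 / (n + 2)
  rOut := 1 / (n + 1)
  rIn_pos := by positivity
  rIn_lt_rOut := by
    apply one_div_lt_one_div_of_lt <;> linarith [(Nat.cast_nonneg n : (0 : ℝ) ≤ n)]

theorem tendsto_mollify {f : ℝ → ℝ} (hf : MemLp f 2 volume) :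
    Tendsto (fun n => eLpNorm (mollify (shrinkingBump n) f - f) 2 volume) atTop (𝓝 0) := by
  -- A Borel representative is needed for the joint measurability in Tonelli's theorem;
  -- mollification does not see the change.
  obtain ⟨g, hg, hfg⟩ := hf.1.aemeasurable
  have hg2 : MemLp g 2 volume := (memLp_congr_ae hfg).1 hf
  have heq : ∀ n, eLpNorm (mollify (shrinkingBump n) f - f) 2 volume =
      eLpNorm (mollify (shrinkingBump n) g - g) 2 volume := fun n => by
    rw [mollify_congr _ hfg]
    exact eLpNorm_congr_ae ((ae_eq_refl _).sub hfg)
  simp only [heq]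
  rw [ENNReal.tendsto_nhds_zero]
  intro ε hε
  have h1 := ENNReal.tendsto_nhds_zero.1 (tendsto_eLpNorm_translate hg2) ε hε
  obtain ⟨δ, hδ, hball⟩ := Metric.eventually_nhds_iff.1 h1
  have h2 := (tendsto_one_div_add_atTop_nhds_zero_nat (𝕜 := ℝ)).eventually_lt_const hδ
  filter_upwards [h2] with n hn
  refine eLpNorm_mollify_sub_le _ hg hg2 fun y hy => hball ?_
  rw [Real.dist_eq, sub_zero]
  exact lt_trans hy hn

/-- A smooth function with the slope of `φ` at a bounded distance from it. -/
theorem exists_smooth_near {φ : ℝ → ℝ} {K : ℝ≥0} (hφ : LipschitzWith K φ) :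
    ∃ θ : ℝ → ℝ, ContDiff ℝ ∞ θ ∧ (∀ x, |φ x - θ x| ≤ K) ∧ ∀ x, |deriv θ x| ≤ K := by
  have hl : LocallyIntegrable φ := hφ.continuous.locallyIntegrable
  -- This kernel has outer radius 1, so averaging moves `φ` by at most `K`.
  set b := shrinkingBump 0 with hb
  refine ⟨mollify b φ, contDiff_mollify _ hl, fun x => ?_, fun x => ?_⟩
  · rw [abs_sub_comm, ← Real.dist_eq]
    refine ContDiffBump.dist_normed_convolution_le hl.aestronglyMeasurable fun y hy => ?_
    refine (hφ.dist_le_mul y x).trans (mul_le_of_le_one_right K.2 ?_)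
    refine (Metric.mem_ball.1 hy).le.trans ?_
    simp [hb, shrinkingBump]
  · rw [← Real.norm_eq_abs]
    refine norm_deriv_le_of_lipschitz (LipschitzWith.of_dist_le_mul fun x y => ?_)
    have e : mollify b φ x - mollify b φ y =
        ∫ z, b.normed volume z * (φ (x - z) - φ (y - z)) := by
      simp only [mul_sub]
      rw [integral_sub (integrable_normed_mul b hl x) (integrable_normed_mul b hl y),
        mollify_apply, mollify_apply]
    have e1 : ∫ z, b.normed volume z * (K * dist x y) = K * dist x y := by
      rw [integral_mul_const, b.integral_normed, one_mul]
    rw [dist_eq_norm, e, ← e1]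
    refine norm_integral_le_of_norm_le (b.integrable_normed.mul_const _) (ae_of_all _ fun z => ?_)
    rw [norm_mul, Real.norm_of_nonneg (b.nonneg_normed z), ← dist_eq_norm]
    refine mul_le_mul_of_nonneg_left ?_ (b.nonneg_normed z)
    have := hφ.dist_le_mul (x - z) (y - z)
    rwa [dist_sub_right] at this

/-! ### Functions on the graph -/

theorem sqrt_slope_le {φ : ℝ → ℝ} {K : ℝ≥0} (hφ : LipschitzWith K φ) (x : ℝ) :
    √(1 + deriv φ x ^ 2) ≤ √(1 + K ^ 2) := by
  have h : |deriv φ x| ≤ K := norm_deriv_le_of_lipschitz hφ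
  refine Real.sqrt_le_sqrt ?_
  rw [← sq_abs (deriv φ x)]
  gcongr

theorem aemeasurable_graph {φ : ℝ → ℝ} (hφ : Continuous φ) {h : ℝ × ℝ → ℝ}
    (hh : AEMeasurable h (surf φ)) : AEMeasurable fun x => h (x, φ x) := by
  have hm : Measurable fun x => (x, φ x) := by fun_prop
  have h1 := hh.comp_measurable hm
  refine h1.mono_ac (withDensity_absolutelyContinuous' (measurable_surfDensity φ).aemeasurable
    (ae_of_all _ fun x => ?_))
  rw [Ne, ENNReal.ofReal_eq_zero, not_le]
  exact one_pos.trans_le (one_le_sqrt_one_add_sq _)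

theorem eLpNorm_graph_le {φ : ℝ → ℝ} (hφ : Continuous φ) {h : ℝ × ℝ → ℝ}
    (hh : AEMeasurable h (surf φ)) :
    eLpNorm (fun x => h (x, φ x)) 2 volume ^ 2 ≤ eLpNorm h 2 (surf φ) ^ 2 := by
  rw [sq_eLpNorm_two, sq_eLpNorm_two]
  exact lintegral_graph_le_surf hφ (hh.pow_const 2).ennreal_ofReal

/-- Squaring produces `1 + φ'²`: one square root is the arc length density, the other is bounded by
the Lipschitz constant. -/
theorem eLpNorm_graph_slope_le {φ : ℝ → ℝ} {K : ℝ≥0} (hφ : LipschitzWith K φ) {h : ℝ × ℝ → ℝ}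
    (hh : AEMeasurable h (surf φ)) :
    eLpNorm (fun x => √(1 + deriv φ x ^ 2) * h (x, φ x)) 2 volume ^ 2 ≤
      ENNReal.ofReal √(1 + K ^ 2) * eLpNorm h 2 (surf φ) ^ 2 := by
  rw [sq_eLpNorm_two, sq_eLpNorm_two,
    lintegral_surf hφ.continuous (hh.pow_const 2).ennreal_ofReal,
    ← lintegral_const_mul' _ _ ENNReal.ofReal_ne_top]
  refine lintegral_mono fun x => ?_
  rw [← ENNReal.ofReal_mul (by positivity), ← ENNReal.ofReal_mul (by positivity)]
  refine ENNReal.ofReal_le_ofReal ?_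
  rw [mul_pow, sq √(1 + deriv φ x ^ 2), mul_assoc]
  exact mul_le_mul_of_nonneg_right (sqrt_slope_le hφ x) (by positivity)

theorem eLpNorm_trace_le {φ : ℝ → ℝ} {K : ℝ≥0} (hφ : LipschitzWith K φ) {h : ℝ × ℝ → ℝ}
    (hh : AEMeasurable h (surf φ)) : eLpNorm h 2 (slotMeasure φ (.inr true)) ^ 2 ≤
      ENNReal.ofReal √(1 + K ^ 2) * eLpNorm (fun x => h (x, φ x)) 2 volume ^ 2 := by
  rw [sq_eLpNorm_two, sq_eLpNorm_two]
  have hle : slotMeasure φ (.inr true) ≤ surf φ := by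
    refine (withDensity_mono (ae_of_all _ fun X => ?_)).trans withDensity_one.le
    rw [boundaryWeight, Pi.one_apply, ENNReal.ofReal_le_one, div_le_one (by positivity)]
    linarith [Real.sqrt_nonneg (euclSq X)]
  refine (lintegral_mono' hle le_rfl).trans ?_
  rw [lintegral_surf hφ.continuous (hh.pow_const 2).ennreal_ofReal,
    ← lintegral_const_mul' _ _ ENNReal.ofReal_ne_top]
  refine lintegral_mono fun x => ?_
  exact mul_le_mul_left (ENNReal.ofReal_le_ofReal (sqrt_slope_le hφ x)) _

theorem integral_surf {φ : ℝ → ℝ} (hφ : Continuous φ) {F : ℝ × ℝ → ℝ}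
    (hF : AEStronglyMeasurable F (surf φ)) :
    ∫ X, F X ∂(surf φ) = ∫ x, √(1 + deriv φ x ^ 2) * F (x, φ x) := by
  have hm : Measurable fun x => (x, φ x) := by fun_prop
  rw [surf, integral_map hm.aemeasurable hF,
    integral_withDensity_eq_integral_toReal_smul (measurable_surfDensity φ)
      (ae_of_all _ fun _ => ENNReal.ofReal_lt_top)]
  refine integral_congr_ae (ae_of_all _ fun x => ?_)
  simp only [smul_eq_mul]
  rw [ENNReal.toReal_ofReal (by positivity)]

theorem measurable_fderiv_tangent (φ : ℝ → ℝ) {ψ : ℝ × ℝ → ℝ} (hψ : ContDiff ℝ ∞ ψ) :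
    Measurable fun X : ℝ × ℝ => fderiv ℝ ψ X (tangent φ X.1) := by
  have h1 : Measurable fun X : ℝ × ℝ => tangent φ X.1 := by
    have := measurable_deriv φ
    unfold tangent
    fun_prop
  have h2 : Continuous fun p : (ℝ × ℝ) × (ℝ × ℝ) => fderiv ℝ ψ p.1 p.2 :=
    ((hψ.continuous_fderiv (by simp)).comp continuous_fst).clm_apply continuous_snd
  exact h2.measurable.comp (measurable_id.prodMk h1)

/-- A tangential derivative on the graph is a derivative in the first coordinate. -/
theorem IsWeakTangDeriv.integral_eq {φ : ℝ → ℝ} (hφ : Continuous φ) {f h : ℝ × ℝ → ℝ}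
    (H : IsWeakTangDeriv φ f h) {α : ℝ → ℝ} (hα : ContDiff ℝ ∞ α) (hs : HasCompactSupport α) :
    ∫ x, f (x, φ x) * deriv α x =
      -∫ x, (√(1 + deriv φ x ^ 2) * h (x, φ x)) * α x := by
  obtain ⟨R, hR⟩ := (hs.image hφ).isBounded.exists_norm_le
  have hR' : ∀ x ∈ tsupport α, |φ x| ≤ |R| := fun x hx =>
    (hR _ (Set.mem_image_of_mem φ hx)).trans (le_abs_self R)
  -- A cutoff in `t` equal to 1 near the graph over the support of `α`. It makes `α(x) β(t)`
  -- compactly supported without altering its values or tangential derivative on the graph. The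
  -- absolute value keeps the radii positive when the bound `R` is negative.
  let β : ContDiffBump (0 : ℝ) := ⟨|R| + 1, |R| + 2, by positivity, by linarith⟩
  have hβ : ∀ x ∈ tsupport α, β =ᶠ[𝓝 (φ x)] 1 := fun x hx => by
    refine β.eventuallyEq_one_of_mem_ball ?_
    rw [mem_ball_zero_iff, Real.norm_eq_abs]
    exact (hR' x hx).trans_lt (lt_add_one _)
  let ψ : ℝ × ℝ → ℝ := fun X => α X.1 * β X.2
  have hβd : ContDiff ℝ ∞ β := β.contDiff
  have hψ : ContDiff ℝ ∞ ψ := (hα.comp contDiff_fst).mul (hβd.comp contDiff_snd)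
  have hψs : HasCompactSupport ψ := by
    refine HasCompactSupport.intro (hs.prod β.hasCompactSupport) fun X hX => ?_
    by_contra hne
    exact hX ⟨subset_tsupport _ (left_ne_zero_of_mul hne),
      subset_tsupport _ (right_ne_zero_of_mul hne)⟩
  have hder : ∀ x, √(1 + deriv φ x ^ 2) * fderiv ℝ ψ (x, φ x) (tangent φ x) = deriv α x := by
    intro x
    have hd : HasFDerivAt ψ (α x • (deriv β (φ x) • ContinuousLinearMap.snd ℝ ℝ ℝ) +
        β (φ x) • (deriv α x • ContinuousLinearMap.fst ℝ ℝ ℝ)) (x, φ x) := by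
      have h1 : HasFDerivAt (fun X : ℝ × ℝ => α X.1)
          (deriv α x • ContinuousLinearMap.fst ℝ ℝ ℝ) (x, φ x) :=
        (hα.differentiable (by simp) x).hasDerivAt.comp_hasFDerivAt (x, φ x)
          (f := Prod.fst) hasFDerivAt_fst
      have h2 : HasFDerivAt (fun X : ℝ × ℝ => β X.2)
          (deriv β (φ x) • ContinuousLinearMap.snd ℝ ℝ ℝ) (x, φ x) :=
        (hβd.differentiable (by simp) (φ x)).hasDerivAt.comp_hasFDerivAt (x, φ x)
          (f := Prod.snd) hasFDerivAt_snd
      exact h1.mul h2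
    have hsq : √(1 + deriv φ x ^ 2) ≠ 0 := (one_pos.trans_le (one_le_sqrt_one_add_sq _)).ne'
    rw [hd.fderiv, tangent, map_smul, smul_eq_mul, ← mul_assoc, mul_one_div_cancel hsq, one_mul]
    simp only [_root_.add_apply, _root_.smul_apply,
      ContinuousLinearMap.coe_snd', ContinuousLinearMap.coe_fst', smul_eq_mul, mul_one]
    by_cases hx : x ∈ tsupport α
    · rw [(hβ x hx).deriv_eq, (hβ x hx).eq_of_nhds]
      simp
    · have h0 : deriv α x = 0 := by
        by_contra hne
        exact hx (tsupport_deriv_subset (subset_tsupport _ hne))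
      rw [image_eq_zero_of_notMem_tsupport hx, h0]
      simp
  have hval : ∀ x, ψ (x, φ x) = α x := by
    intro x
    by_cases hx : x ∈ tsupport α
    · simp only [ψ]
      rw [(hβ x hx).eq_of_nhds]
      simp
    · simp [ψ, image_eq_zero_of_notMem_tsupport hx]
  have e := H.2.2 ψ hψ hψs
  have i1 := integral_surf hφ (H.1.aestronglyMeasurable.mul
    (measurable_fderiv_tangent φ hψ).aestronglyMeasurable)
  have i2 := integral_surf hφ (H.2.1.aestronglyMeasurable.mul
    hψ.continuous.aestronglyMeasurable)
  have e := i1.symm.trans (e.trans (congrArg _ i2))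
  refine (integral_congr_ae (ae_of_all _ fun x => ?_)).trans
    (e.trans (congrArg _ (integral_congr_ae (ae_of_all _ fun x => ?_))))
  · rw [Pi.mul_apply, ← hder x]; ring
  · simp only [Pi.mul_apply, hval x]; ring

/-! ### Extension into the domain -/

/-- The function `α` of the first coordinate, cut off outside a strip about the graph of `θ`. -/
def stripExt (θ η α : ℝ → ℝ) (X : ℝ × ℝ) : ℝ := α X.1 * η (X.2 - θ X.1)

section stripExt

variable {θ η α : ℝ → ℝ}

theorem contDiff_stripExt (hθ : ContDiff ℝ ∞ θ) (hη : ContDiff ℝ ∞ η) (hα : ContDiff ℝ ∞ α) :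
    ContDiff ℝ ∞ (stripExt θ η α) :=
  (hα.comp contDiff_fst).mul (hη.comp (contDiff_snd.sub (hθ.comp contDiff_fst)))

theorem classGrad_stripExt_zero (hθ : ContDiff ℝ ∞ θ) (hη : ContDiff ℝ ∞ η)
    (hα : ContDiff ℝ ∞ α) (x t : ℝ) : classGrad (stripExt θ η α) (x, t) 0 =
      deriv α x * η (t - θ x) - α x * deriv η (t - θ x) * deriv θ x := by
  rw [classGrad_zero (contDiff_stripExt hθ hη hα)]
  have h1 := (hα.differentiable (by simp) x).hasDerivAt
  have h2 := (hθ.differentiable (by simp) x).hasDerivAt.const_sub t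
  have h3 := (hη.differentiable (by simp) (t - θ x)).hasDerivAt.comp x h2
  refine (h1.mul h3).deriv.trans ?_
  simp only [Function.comp]
  ring

theorem classGrad_stripExt_one (hθ : ContDiff ℝ ∞ θ) (hη : ContDiff ℝ ∞ η)
    (hα : ContDiff ℝ ∞ α) (x t : ℝ) :
    classGrad (stripExt θ η α) (x, t) 1 = α x * deriv η (t - θ x) := by
  rw [classGrad_one (contDiff_stripExt hθ hη hα)]
  have h2 := (hasDerivAt_id t).sub_const (θ x)
  have h3 := (hη.differentiable (by simp) (t - θ x)).hasDerivAt.comp t h2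
  refine (h3.const_mul (α x)).deriv.trans ?_
  ring

end stripExt

/-- Each vertical line meets the strip in a segment of length `2R`. -/
theorem lintegral_strip_le {θ : ℝ → ℝ} {F : ℝ × ℝ → ℝ} (hF : Measurable F) {R : ℝ}
    {h : ℝ → ℝ} (hle : ∀ x t, F (x, t) ^ 2 ≤ h x)
    (h0 : ∀ x t, R < |t - θ x| → F (x, t) = 0) :
    eLpNorm F 2 volume ^ 2 ≤ ENNReal.ofReal (2 * R) * ∫⁻ x, ENNReal.ofReal (h x) := by
  rw [sq_eLpNorm_two, Measure.volume_eq_prod, lintegral_prod _ (by fun_prop),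
    ← lintegral_const_mul' _ _ ENNReal.ofReal_ne_top]
  refine lintegral_mono fun x => ?_
  calc ∫⁻ t, ENNReal.ofReal (F (x, t) ^ 2)
      ≤ ∫⁻ t, (Set.Icc (θ x - R) (θ x + R)).indicator (fun _ => ENNReal.ofReal (h x)) t := by
        refine lintegral_mono fun t => ?_
        by_cases ht : t ∈ Set.Icc (θ x - R) (θ x + R)
        · rw [Set.indicator_of_mem ht]
          exact ENNReal.ofReal_le_ofReal (hle x t)
        · have : R < |t - θ x| := by
            by_contra hn
            rw [not_lt, abs_le] at hn
            exact ht ⟨by linarith, by linarith⟩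
          simp [h0 x t this]
    _ = _ := by
        rw [lintegral_indicator measurableSet_Icc, setLIntegral_const, Real.volume_Icc, mul_comm]
        congr 2; ring

theorem slotMeasure_le_volume (φ : ℝ → ℝ) {s : Fin 2 ⊕ Bool} (hs : s ≠ .inr true) :
    slotMeasure φ s ≤ volume := by
  rcases s with i | (_ | _)
  · exact Measure.restrict_le_self
  · exact (interior_le φ).trans Measure.restrict_le_self
  · exact absurd rfl hs

/-- The extension is bounded from `W^{1,2}` of the line. -/
theorem exists_extension_bound {φ : ℝ → ℝ} {K : ℝ≥0} (hφ : LipschitzWith K φ) :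
    ∃ (θ η : ℝ → ℝ) (M : ℝ≥0), ContDiff ℝ ∞ θ ∧ ContDiff ℝ ∞ η ∧
      (∀ α x, stripExt θ η α (x, φ x) = α x) ∧
      ∀ α, ContDiff ℝ ∞ α → ∀ s, eLpNorm (slotFun (stripExt θ η α) (classGrad (stripExt θ η α))
        (stripExt θ η α) s) 2 (slotMeasure φ s) ^ 2 ≤
          M * (eLpNorm α 2 volume ^ 2 + eLpNorm (deriv α) 2 volume ^ 2) := by
  obtain ⟨θ, hθ, hθφ, hθ'⟩ := exists_smooth_near hφ
  have hK : (0 : ℝ) ≤ K := K.2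
  -- The graph of `φ` satisfies `|t - θ(x)| ≤ K`, so it lies where `η = 1`.
  let η : ContDiffBump (0 : ℝ) := ⟨K + 1, K + 2, by positivity, by linarith⟩
  have hη : ContDiff ℝ ∞ η := η.contDiff
  have hηs : HasCompactSupport η := η.hasCompactSupport
  obtain ⟨N, hN⟩ := hηs.deriv.exists_bound_of_continuous (hη.continuous_deriv (by simp))
  have hone : ∀ α x, stripExt θ η α (x, φ x) = α x := fun α x => by
    have : η (φ x - θ x) = 1 := η.one_of_mem_closedBall (by
      rw [mem_closedBall_zero_iff, Real.norm_eq_abs]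
      exact (hθφ x).trans (lt_add_one _).le)
    rw [stripExt, this, mul_one]
  have hz : ∀ r : ℝ, K + 2 < |r| → η r = 0 ∧ deriv η r = 0 := fun r hr => by
    have hnm : r ∉ tsupport η := by
      rw [η.tsupport_eq, mem_closedBall_zero_iff, Real.norm_eq_abs, not_le]
      exact hr
    refine ⟨image_eq_zero_of_notMem_tsupport hnm, ?_⟩
    by_contra hne
    exact hnm (tsupport_deriv_subset (subset_tsupport _ hne))
  have hη1 : ∀ r, η r ^ 2 ≤ 1 := fun r => pow_le_one₀ η.nonneg η.le_one
  have hηN : ∀ r, deriv η r ^ 2 ≤ N ^ 2 := fun r => by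
    rw [← sq_abs]
    exact pow_le_pow_left₀ (abs_nonneg _) (hN r) 2
  have hθK : ∀ x, deriv θ x ^ 2 ≤ K ^ 2 := fun r => by
    rw [← sq_abs]
    exact pow_le_pow_left₀ (abs_nonneg _) (hθ' r) 2
  -- Since `(p - q)² ≤ 2p² + 2q²`, the horizontal derivative costs `2` and `2N²K²`; the vertical one
  -- costs `N²`.
  set P : ℝ := 2 + N ^ 2 + 2 * (N ^ 2 * K ^ 2) with hP
  have hP0 : 0 ≤ P := by positivity
  -- The first summand serves the gradient and the function on a strip of width `2(K + 2)`, the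
  -- second serves the trace.
  refine ⟨θ, η, Real.toNNReal (2 * (K + 2) * P) + Real.toNNReal √(1 + K ^ 2), hθ, hη, hone,
    fun α hα s => ?_⟩
  have hψ := contDiff_stripExt hθ hη hα
  have hψm : Measurable (stripExt θ η α) := hψ.continuous.measurable
  rw [ENNReal.coe_add, add_mul]
  by_cases hs : s = .inr true
  · subst hs
    refine le_trans ?_ le_add_self
    refine (eLpNorm_trace_le hφ hψm.aemeasurable).trans ?_
    simp only [hone]
    exact mul_le_mul_right le_self_add _
  refine le_trans ?_ le_self_add
  refine (pow_le_pow_left' (eLpNorm_mono_measure _ (slotMeasure_le_volume φ hs)) 2).trans ?_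
  have hsum : eLpNorm α 2 volume ^ 2 + eLpNorm (deriv α) 2 volume ^ 2 =
      ∫⁻ x, ENNReal.ofReal (α x ^ 2 + deriv α x ^ 2) := by
    have := hα.continuous.measurable
    rw [sq_eLpNorm_two, sq_eLpNorm_two, ← lintegral_add_left (by fun_prop)]
    exact lintegral_congr fun x => (ENNReal.ofReal_add (sq_nonneg _) (sq_nonneg _)).symm
  have hfin : ENNReal.ofReal (2 * (K + 2)) * ∫⁻ x, ENNReal.ofReal (P * (α x ^ 2 + deriv α x ^ 2)) =
      (Real.toNNReal (2 * (K + 2) * P) : ℝ≥0∞) *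
        (eLpNorm α 2 volume ^ 2 + eLpNorm (deriv α) 2 volume ^ 2) := by
    rw [hsum]
    simp only [ENNReal.ofReal_mul hP0]
    rw [lintegral_const_mul' _ _ ENNReal.ofReal_ne_top, ← mul_assoc,
      ← ENNReal.ofReal_mul (by positivity)]
    rfl
  rw [← hfin]
  rcases s with i | (_ | _)
  · refine lintegral_strip_le (θ := θ) (continuous_classGrad hψ i).measurable ?_ ?_
    · intro x t
      have q1 := hη1 (t - θ x)
      have q2 := hηN (t - θ x)
      have q3 := hθK x
      have q4 : deriv η (t - θ x) ^ 2 * deriv θ x ^ 2 ≤ N ^ 2 * K ^ 2 :=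
        mul_le_mul q2 q3 (sq_nonneg _) (sq_nonneg _)
      have q5 := mul_le_mul_of_nonneg_left q1 (sq_nonneg (deriv α x))
      have q6 := mul_le_mul_of_nonneg_left q4 (sq_nonneg (α x))
      have q7 := mul_le_mul_of_nonneg_left q2 (sq_nonneg (α x))
      have q8 : 0 ≤ (N ^ 2 + 2 * (N ^ 2 * K ^ 2)) * deriv α x ^ 2 := by positivity
      have q9 : 0 ≤ (2 + 2 * (N ^ 2 * K ^ 2)) * α x ^ 2 := by positivity
      have q10 : 0 ≤ (2 + N ^ 2) * α x ^ 2 := by positivity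
      have q11 : 0 ≤ P * deriv α x ^ 2 := by positivity
      fin_cases i
      · simp only [Fin.zero_eta]
        rw [classGrad_stripExt_zero hθ hη hα]
        have := sq_nonneg (deriv α x * η (t - θ x) + α x * deriv η (t - θ x) * deriv θ x)
        rw [hP]
        nlinarith
      · simp only [Fin.mk_one]
        rw [classGrad_stripExt_one hθ hη hα, hP]
        rw [hP] at q11
        nlinarith
    · intro x t ht
      obtain ⟨z1, z2⟩ := hz _ ht
      fin_cases i
      · simp only [Fin.zero_eta]
        rw [classGrad_stripExt_zero hθ hη hα, z1, z2]; ring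
      · simp only [Fin.mk_one]
        rw [classGrad_stripExt_one hθ hη hα, z2]; ring
  · refine lintegral_strip_le (θ := θ) hψm ?_ ?_
    · intro x t
      have q1 := mul_le_mul_of_nonneg_left (hη1 (t - θ x)) (sq_nonneg (α x))
      have q2 : 0 ≤ P * deriv α x ^ 2 := by positivity
      have q3 : 0 ≤ (1 + N ^ 2 + 2 * (N ^ 2 * K ^ 2)) * α x ^ 2 := by positivity
      rw [stripExt, mul_pow]
      simp only
      rw [hP] at q2 ⊢
      linarith
    · intro x t ht
      rw [stripExt, (hz _ ht).1, mul_zero]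
  · exact absurd rfl hs

/-! ### Passage from smooth boundary data to `W^{1,2}`. -/

theorem memLp_mollify (b : ContDiffBump (0 : ℝ)) {f : ℝ → ℝ} (hf : MemLp f 2 volume) :
    MemLp (mollify b f) 2 volume := by
  obtain ⟨g, hg, hfg⟩ := hf.1.aemeasurable
  have hg2 : MemLp g 2 volume := (memLp_congr_ae hfg).1 hf
  rw [mollify_congr b hfg]
  have h1 : eLpNorm (mollify b g - g) 2 volume ≤ eLpNorm g 2 volume + eLpNorm g 2 volume := by
    refine eLpNorm_mollify_sub_le b hg hg2 fun y _ => ?_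
    have hp := measurePreserving_sub_right (volume : Measure ℝ) y
    refine (eLpNorm_sub_le (hg2.1.comp_measurePreserving hp) hg2.1 (by norm_num)).trans ?_
    exact add_le_add_left (eLpNorm_comp_measurePreserving hg2.1 hp).le _
  have hm : AEStronglyMeasurable (mollify b g) volume :=
    (contDiff_mollify b (hg2.locallyIntegrable (by norm_num))).continuous.aestronglyMeasurable
  have h2 : MemLp (mollify b g - g) 2 volume :=
    ⟨hm.sub hg2.1, h1.trans_lt (ENNReal.add_lt_top.2 ⟨hg2.2, hg2.2⟩)⟩
  simpa using h2.add hg2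

theorem tendsto_toLp {α : Type*} [MeasurableSpace α] {μ : Measure α} {F : ℕ → α → ℝ} {f : α → ℝ}
    (hF : ∀ n, MemLp (F n) 2 μ) (hf : MemLp f 2 μ)
    (h : Tendsto (fun n => eLpNorm (F n - f) 2 μ) atTop (𝓝 0)) :
    Tendsto (fun n => (hF n).toLp (F n)) atTop (𝓝 (hf.toLp f)) := by
  rw [tendsto_iff_edist_tendsto_0]
  refine h.congr fun n => ?_
  rw [Lp.edist_toLp_toLp]

theorem bdrySobNorm_sq {φ : ℝ → ℝ} {f : ℝ × ℝ → ℝ} (h : bdrySobNorm φ f < ⊤) :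
    IsWeakTangDeriv φ f (weakTangDeriv φ f) ∧ bdrySobNorm φ f ^ 2 =
      eLpNorm f 2 (surf φ) ^ 2 + eLpNorm (weakTangDeriv φ f) 2 (surf φ) ^ 2 := by
  by_cases hex : ∃ g, IsWeakTangDeriv φ f g
  · have : weakTangDeriv φ f = hex.choose := by simp [weakTangDeriv, hex]
    refine ⟨this ▸ hex.choose_spec, ?_⟩
    rw [bdrySobNorm, if_pos hex, ← ENNReal.rpow_natCast, ← ENNReal.rpow_mul]
    norm_num only [Nat.cast_ofNat, ENNReal.rpow_one]
  · simp [bdrySobNorm, hex] at h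

/-- Functions of `W^{1,2}` of the graph have extensions into the domain. -/
theorem exists_extension {φ : ℝ → ℝ} {K : ℝ≥0} (hφ : LipschitzWith K φ) :
    ∃ C : ℝ≥0, ∀ f₀ : ℝ × ℝ → ℝ, bdrySobNorm φ f₀ < ⊤ → ∃ x ∈ traceSpace φ,
      x (.inr true) =ᵐ[slotMeasure φ (.inr true)] f₀ ∧ ‖x‖ₑ ≤ C * bdrySobNorm φ f₀ := by
  obtain ⟨θ, η, M, hθ, hη, hone, hbd⟩ := exists_extension_bound hφ
  have hc := hφ.continuous
  set E := stripExt θ η with hE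
  -- Stating the bound through the classes `a` and `d` lets it apply to the differences `α n - α m`.
  -- The factor 4 counts the components of the ambient space.
  have hrep : ∀ α, ContDiff ℝ ∞ α → ∀ a d : Lp ℝ 2 (volume : Measure ℝ), a =ᵐ[volume] α →
      d =ᵐ[volume] deriv α → ∃ X : Ambient φ, Represents X (slotFun (E α) (classGrad (E α)) (E α)) ∧
        ‖X‖ ^ 2 ≤ 4 * M * (‖a‖ ^ 2 + ‖d‖ ^ 2) := by
    intro α hα a d ha hd
    have hψ : ContDiff ℝ ∞ (E α) := contDiff_stripExt hθ hη hα
    have hS : eLpNorm α 2 volume ^ 2 + eLpNorm (deriv α) 2 volume ^ 2 = ‖a‖ₑ ^ 2 + ‖d‖ₑ ^ 2 := by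
      rw [Lp.enorm_def, Lp.enorm_def, eLpNorm_congr_ae ha, eLpNorm_congr_ae hd]
    have hb := hbd α hα
    rw [hS] at hb
    have hfin : (M : ℝ≥0∞) * (‖a‖ₑ ^ 2 + ‖d‖ₑ ^ 2) < ⊤ :=
      ENNReal.mul_lt_top ENNReal.coe_lt_top (ENNReal.add_lt_top.2
        ⟨ENNReal.pow_lt_top enorm_lt_top, ENNReal.pow_lt_top enorm_lt_top⟩)
    have hmeas : ∀ s, Continuous (slotFun (E α) (classGrad (E α)) (E α) s) := by
      intro s
      rcases s with i | (_ | _)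
      · exact continuous_classGrad hψ i
      · exact hψ.continuous
      · exact hψ.continuous
    obtain ⟨X, hX⟩ := exists_rep (φ := φ) (c := slotFun (E α) (classGrad (E α)) (E α)) fun s =>
      ⟨(hmeas s).aestronglyMeasurable, lt_top_of_sq_lt_top ((hb s).trans_lt hfin)⟩
    refine ⟨X, hX, ?_⟩
    have h1 : ‖X‖ₑ ^ 2 ≤ 4 * (M * (‖a‖ₑ ^ 2 + ‖d‖ₑ ^ 2)) := by
      rw [hX.enorm_sq]
      refine (Finset.sum_le_sum fun s _ => hb s).trans ?_
      simp
    have h2 : 4 * (M * (‖a‖ₑ ^ 2 + ‖d‖ₑ ^ 2)) =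
        ENNReal.ofReal (4 * M * (‖a‖ ^ 2 + ‖d‖ ^ 2)) := by
      rw [ENNReal.ofReal_mul (by positivity), ENNReal.ofReal_mul (by positivity),
        ENNReal.ofReal_add (by positivity) (by positivity), ENNReal.ofReal_pow (norm_nonneg _),
        ENNReal.ofReal_pow (norm_nonneg _), ofReal_norm, ofReal_norm, ENNReal.ofReal_coe_nnreal,
        mul_assoc]
      simp
    rw [h2, ← ofReal_norm, ← ENNReal.ofReal_pow (norm_nonneg _),
      ENNReal.ofReal_le_ofReal_iff (by positivity)] at h1
    exact h1
  refine ⟨NNReal.sqrt (4 * M * NNReal.sqrt (1 + K ^ 2)), fun f₀ hf₀ => ?_⟩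
  obtain ⟨hw, hnorm⟩ := bdrySobNorm_sq hf₀
  set h := weakTangDeriv φ f₀ with hh
  have hf₀m : AEMeasurable f₀ (surf φ) := hw.1.aestronglyMeasurable.aemeasurable
  have hhm : AEMeasurable h (surf φ) := hw.2.1.aestronglyMeasurable.aemeasurable
  have hsum : eLpNorm f₀ 2 (surf φ) ^ 2 + eLpNorm h 2 (surf φ) ^ 2 < ⊤ := by
    rw [← hnorm]; exact ENNReal.pow_lt_top hf₀
  obtain ⟨hs1, hs2⟩ := ENNReal.add_lt_top.1 hsum
  set f : ℝ → ℝ := fun x => f₀ (x, φ x) with hfdef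
  set k : ℝ → ℝ := fun x => √(1 + deriv φ x ^ 2) * h (x, φ x) with hkdef
  have hfle := eLpNorm_graph_le hc hf₀m
  have hkle := eLpNorm_graph_slope_le hφ hhm
  have hf : MemLp f 2 volume := ⟨(aemeasurable_graph hc hf₀m).aestronglyMeasurable,
    lt_top_of_sq_lt_top (hfle.trans_lt hs1)⟩
  have hk : MemLp k 2 volume := by
    refine ⟨(AEMeasurable.mul ?_ (aemeasurable_graph hc hhm)).aestronglyMeasurable,
      lt_top_of_sq_lt_top (hkle.trans_lt (ENNReal.mul_lt_top ENNReal.ofReal_lt_top hs2))⟩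
    have := measurable_deriv φ
    fun_prop
  have hfl : LocallyIntegrable f := hf.locallyIntegrable (by norm_num)
  set α : ℕ → ℝ → ℝ := fun n => mollify (shrinkingBump n) f with hα
  have hαs : ∀ n, ContDiff ℝ ∞ (α n) := fun n => contDiff_mollify _ hfl
  have hα' : ∀ n, deriv (α n) = mollify (shrinkingBump n) k := fun n =>
    deriv_mollify _ hfl fun β hβ hβs => hw.integral_eq hc hβ hβs
  have hαm : ∀ n, MemLp (α n) 2 volume := fun n => memLp_mollify _ hf
  have hαm' : ∀ n, MemLp (deriv (α n)) 2 volume := fun n => by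
    rw [hα']; exact memLp_mollify _ hk
  have ha := tendsto_toLp hαm hf (tendsto_mollify hf)
  have hd := tendsto_toLp hαm' hk (by simpa only [hα'] using tendsto_mollify hk)
  set a := fun n => (hαm n).toLp (α n) with hadef
  set d := fun n => (hαm' n).toLp (deriv (α n)) with hddef
  choose X hX hXn using fun n => hrep (α n) (hαs n) (a n) (d n) (hαm n).coeFn_toLp
    (hαm' n).coeFn_toLp
  -- The extension is linear in `α`, so the bound for a single function controls differences.
  have hdiff : ∀ n m, ‖X n - X m‖ ^ 2 ≤ 4 * M * (‖a n - a m‖ ^ 2 + ‖d n - d m‖ ^ 2) := by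
    intro n m
    have hder : deriv (α n - α m) = deriv (α n) - deriv (α m) := by
      funext x
      exact deriv_sub ((hαs n).differentiable (by simp) x) ((hαs m).differentiable (by simp) x)
    obtain ⟨Y, hY, hYn⟩ := hrep (α n - α m) ((hαs n).sub (hαs m)) (a n - a m) (d n - d m)
      ((Lp.coeFn_sub _ _).trans ((hαm n).coeFn_toLp.sub (hαm m).coeFn_toLp))
      (by rw [hder]
          exact (Lp.coeFn_sub _ _).trans ((hαm' n).coeFn_toLp.sub (hαm' m).coeFn_toLp))
    have e1 : E (α n - α m) = E (α n) - E (α m) := by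
      funext Z
      simp only [hE, stripExt, Pi.sub_apply]; ring
    have e2 : classGrad (E (α n) - E (α m)) = classGrad (E (α n)) - classGrad (E (α m)) := by
      funext Z i
      simp only [classGrad, Pi.sub_apply]
      rw [fderiv_sub ((contDiff_stripExt hθ hη (hαs n)).differentiable (by simp) Z)
        ((contDiff_stripExt hθ hη (hαs m)).differentiable (by simp) Z)]
      rfl
    rw [e1, e2, slotFun_sub] at hY
    rw [((hX n).sub (hX m)).ext hY]
    exact hYn
  have hcauchy : CauchySeq X := by
    rw [cauchySeq_iff_tendsto_dist_atTop_0]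
    have t1 := cauchySeq_iff_tendsto_dist_atTop_0.1 ha.cauchySeq
    have t2 := cauchySeq_iff_tendsto_dist_atTop_0.1 hd.cauchySeq
    have t3 := ((((t1.pow 2).add (t2.pow 2)).const_mul (4 * (M : ℝ))).sqrt)
    rw [show √(4 * (M : ℝ) * (0 ^ 2 + 0 ^ 2)) = 0 by simp] at t3
    refine squeeze_zero (fun _ => dist_nonneg) (fun p => ?_) t3
    refine Real.le_sqrt_of_sq_le ?_
    rw [dist_eq_norm, dist_eq_norm, dist_eq_norm]
    exact hdiff p.1 p.2
  obtain ⟨x, hx⟩ := cauchySeq_tendsto_of_complete hcauchy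
  refine ⟨x, ?_, ?_, ?_⟩
  · exact mem_closure_of_tendsto hx (Eventually.of_forall fun n =>
      ⟨E (α n), contDiff_stripExt hθ hη (hαs n), hX n⟩)
  · have hg : MemLp f₀ 2 (slotMeasure φ (.inr true)) := by
      refine ⟨hw.1.aestronglyMeasurable.mono_ac (withDensity_absolutelyContinuous _ _),
        lt_top_of_sq_lt_top ((eLpNorm_trace_le hφ hf₀m).trans_lt
          (ENNReal.mul_lt_top ENNReal.ofReal_lt_top (ENNReal.pow_lt_top hf.2)))⟩
    have t1 : Tendsto (fun n => X n (.inr true)) atTop (𝓝 (x (.inr true))) :=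
      ((PiLp.continuous_apply 2 (fun s => Lp ℝ 2 (slotMeasure φ s)) (.inr true)).tendsto x).comp hx
    -- The extensions equal `α n` on the graph, and `α n` tends to `f` in `L²` of the line; this
    -- identifies the trace of the limit.
    have t2 : Tendsto (fun n => X n (.inr true)) atTop (𝓝 (hg.toLp f₀)) := by
      rw [tendsto_iff_edist_tendsto_0]
      refine tendsto_zero_of_sq ?_
      have t3 : Tendsto (fun n => ENNReal.ofReal √(1 + K ^ 2) * eLpNorm (α n - f) 2 volume ^ 2)
          atTop (𝓝 0) := by
        have := ENNReal.Tendsto.const_mul (a := ENNReal.ofReal √(1 + K ^ 2))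
          (ENNReal.Tendsto.pow (n := 2) (tendsto_mollify hf)) (Or.inr ENNReal.ofReal_ne_top)
        simpa using this
      refine tendsto_of_tendsto_of_tendsto_of_le_of_le tendsto_const_nhds t3
        (fun _ => zero_le) fun n => ?_
      have hEm : AEMeasurable (E (α n)) (surf φ) :=
        (contDiff_stripExt hθ hη (hαs n)).continuous.measurable.aemeasurable
      have e1 := eLpNorm_trace_le hφ (hEm.sub hf₀m)
      have e2 : (fun x => (E (α n) - f₀) (x, φ x)) = α n - f := by
        funext y
        rw [Pi.sub_apply, Pi.sub_apply, hone]
      rw [e2] at e1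
      refine le_trans (le_of_eq ?_) e1
      rw [edist_eq_enorm_sub, Lp.enorm_def]
      congr 1
      refine eLpNorm_congr_ae ?_
      exact (Lp.coeFn_sub _ _).trans ((hX n (.inr true)).sub hg.coeFn_toLp)
    rw [tendsto_nhds_unique t1 t2]
    exact hg.coeFn_toLp
  · have hlim : ‖x‖ ^ 2 ≤ 4 * M * (‖hf.toLp f‖ ^ 2 + ‖hk.toLp k‖ ^ 2) :=
      le_of_tendsto_of_tendsto' (hx.norm.pow 2)
        (((ha.norm.pow 2).add (hd.norm.pow 2)).const_mul _) hXn
    have hlim' : ‖x‖ₑ ^ 2 ≤ 4 * M * (eLpNorm f 2 volume ^ 2 + eLpNorm k 2 volume ^ 2) := by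
      have := ENNReal.ofReal_le_ofReal hlim
      rw [ENNReal.ofReal_mul (by positivity), ENNReal.ofReal_mul (by positivity),
        ENNReal.ofReal_add (by positivity) (by positivity), ENNReal.ofReal_pow (norm_nonneg _),
        ENNReal.ofReal_pow (norm_nonneg _), ENNReal.ofReal_pow (norm_nonneg _), ofReal_norm,
        ofReal_norm, ofReal_norm, ENNReal.ofReal_coe_nnreal, Lp.enorm_toLp, Lp.enorm_toLp] at this
      simpa using this
    rw [← ENNReal.pow_le_pow_left_iff two_ne_zero, mul_pow, hnorm]
    refine hlim'.trans ?_
    have hs : ENNReal.ofReal √(1 + (K : ℝ) ^ 2) = (NNReal.sqrt (1 + K ^ 2) : ℝ≥0) := by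
      rw [← ENNReal.ofReal_coe_nnreal]
      congr 1
      simp
    have h1s : (1 : ℝ≥0∞) ≤ (NNReal.sqrt (1 + K ^ 2) : ℝ≥0) := by
      rw [← hs, ENNReal.one_le_ofReal]
      exact one_le_sqrt_one_add_sq _
    rw [hs] at hkle
    rw [← ENNReal.coe_pow, NNReal.sq_sqrt, ENNReal.coe_mul, ENNReal.coe_mul, mul_assoc, mul_assoc,
      mul_assoc]
    refine mul_le_mul_right (mul_le_mul_right ?_ _) _
    rw [mul_add]
    exact add_le_add (hfle.trans (le_mul_of_one_le_left zero_le h1s)) hkle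

/-! ### The bilinear form -/

/-- A component of the gradient. -/
def gradComp (φ : ℝ → ℝ) (i : Fin 2) : Ambient φ →L[ℝ] Lp ℝ 2 (volume.restrict (region φ)) :=
  PiLp.proj 2 (fun s => Lp ℝ 2 (slotMeasure φ s)) (.inl i)

theorem norm_gradComp_le {φ : ℝ → ℝ} (i : Fin 2) (x : Ambient φ) : ‖gradComp φ i x‖ ≤ ‖x‖ :=
  PiLp.norm_apply_le x (.inl i)

/-- Multiplication by a bounded function. -/
def mulBounded {α : Type*} [MeasurableSpace α] {μ : Measure α} (a : Lp ℝ ⊤ μ) :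
    Lp ℝ 2 μ →L[ℝ] Lp ℝ 2 μ :=
  (ContinuousLinearMap.mul ℝ ℝ).holderL μ ⊤ 2 2 a

theorem mulBounded_coeFn {α : Type*} [MeasurableSpace α] {μ : Measure α} (a : Lp ℝ ⊤ μ)
    (f : Lp ℝ 2 μ) : mulBounded a f =ᵐ[μ] fun x => a x * f x :=
  (ContinuousLinearMap.mul ℝ ℝ).coeFn_holder a f

theorem norm_mulBounded_le {α : Type*} [MeasurableSpace α] {μ : Measure α} (a : Lp ℝ ⊤ μ)
    (f : Lp ℝ 2 μ) : ‖mulBounded a f‖ ≤ ‖a‖ * ‖f‖ := by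
  refine ((ContinuousLinearMap.mul ℝ ℝ).norm_holder_apply_apply_le a f).trans ?_
  rw [ContinuousLinearMap.opNorm_mul, one_mul]

/-- The bilinear form of a coefficient matrix. -/
theorem exists_form {φ : ℝ → ℝ} {lam Lam : ℝ} {A : ℝ × ℝ → Matrix (Fin 2) (Fin 2) ℝ}
    (hA : IsEllipticCoeff (region φ) lam Lam A) :
    ∃ B : Ambient φ →L[ℝ] Ambient φ →L[ℝ] ℝ,
      (∀ x y, B x y = ∫ X in region φ, ∑ i, ∑ j,
        A X i j * gradComp φ j x X * gradComp φ i y X) ∧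
      (∀ x y, |B x y| ≤ 4 * |Lam| * ‖x‖ * ‖y‖) ∧
      ∀ x, lam * (‖gradComp φ 0 x‖ ^ 2 + ‖gradComp φ 1 x‖ ^ 2) ≤ B x x := by
  set μ := volume.restrict (region φ) with hμ
  have hb : ∀ i j, ∀ᵐ X ∂μ, ‖A X i j‖ ≤ |Lam| := fun i j => by
    filter_upwards [hA.bounded i j] with X hX
    exact hX.trans (le_abs_self _)
  have hmem : ∀ i j, MemLp (fun X => A X i j) ⊤ μ := fun i j =>
    memLp_top_of_bound (hA.measurable i j).aestronglyMeasurable _ (hb i j)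
  set a : Fin 2 → Fin 2 → Lp ℝ ⊤ μ := fun i j => (hmem i j).toLp _ with ha
  have hnorm : ∀ i j, ‖a i j‖ ≤ |Lam| := fun i j => by
    rw [ha, Lp.norm_toLp]
    refine ENNReal.toReal_le_of_le_ofReal (abs_nonneg _) ?_
    exact eLpNormEssSup_le_of_ae_bound (hb i j)
  let S : Fin 2 → Fin 2 → Ambient φ →L[ℝ] Ambient φ →L[ℝ] ℝ := fun i j =>
    (innerSL ℝ).bilinearComp (mulBounded (a i j) ∘L gradComp φ j) (gradComp φ i)
  have hS : ∀ i j x y, S i j x y = inner ℝ (mulBounded (a i j) (gradComp φ j x))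
      (gradComp φ i y) := fun i j x y => rfl
  have hSae : ∀ i j x y, (fun X => inner ℝ (mulBounded (a i j) (gradComp φ j x) X)
      (gradComp φ i y X)) =ᵐ[μ] fun X => A X i j * gradComp φ j x X * gradComp φ i y X := by
    intro i j x y
    filter_upwards [mulBounded_coeFn (a i j) (gradComp φ j x), (hmem i j).coeFn_toLp] with X h1 h2
    rw [h1, ha, h2]
    simp [mul_comm]
  have hSint : ∀ i j x y, Integrable
      (fun X => A X i j * gradComp φ j x X * gradComp φ i y X) μ := fun i j x y =>
    (L2.integrable_inner (𝕜 := ℝ) (mulBounded (a i j) (gradComp φ j x)) (gradComp φ i y)).congr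
      (hSae i j x y)
  have hSeq : ∀ i j x y, S i j x y = ∫ X, A X i j * gradComp φ j x X * gradComp φ i y X ∂μ :=
    fun i j x y => by rw [hS, L2.inner_def, integral_congr_ae (hSae i j x y)]
  have hSb : ∀ i j x y, |S i j x y| ≤ |Lam| * ‖x‖ * ‖y‖ := fun i j x y => by
    rw [hS]
    refine (abs_real_inner_le_norm _ _).trans ?_
    have h1 := norm_mulBounded_le (a i j) (gradComp φ j x)
    have h2 := norm_gradComp_le j x
    have h3 := norm_gradComp_le i y
    refine mul_le_mul (h1.trans ?_) h3 (norm_nonneg _) (by positivity)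
    exact mul_le_mul (hnorm i j) h2 (norm_nonneg _) (abs_nonneg _)
  have hBeq : ∀ x y, (∑ i, ∑ j, S i j) x y = ∫ X, ∑ i, ∑ j,
      A X i j * gradComp φ j x X * gradComp φ i y X ∂μ := fun x y => by
    rw [integral_finsetSum _ fun i _ => integrable_finsetSum _ fun j _ => hSint i j x y]
    simp only [_root_.sum_apply]
    refine Finset.sum_congr rfl fun i _ => ?_
    rw [integral_finsetSum _ fun j _ => hSint i j x y]
    exact Finset.sum_congr rfl fun j _ => hSeq i j x y
  refine ⟨∑ i, ∑ j, S i j, hBeq, fun x y => ?_, fun x => ?_⟩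
  · simp only [_root_.sum_apply]
    calc |∑ i, ∑ j, S i j x y| ≤ ∑ i, ∑ j, |S i j x y| :=
          (Finset.abs_sum_le_sum_abs _ _).trans
            (Finset.sum_le_sum fun i _ => Finset.abs_sum_le_sum_abs _ _)
      _ ≤ ∑ _i : Fin 2, ∑ _j : Fin 2, |Lam| * ‖x‖ * ‖y‖ :=
          Finset.sum_le_sum fun i _ => Finset.sum_le_sum fun j _ => hSb i j x y
      _ = 4 * |Lam| * ‖x‖ * ‖y‖ := by simp; ring
  · have hsq : ∀ i, Integrable (fun X => gradComp φ i x X * gradComp φ i x X) μ := fun i => by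
      simpa [← sq] using L2.integrable_inner (𝕜 := ℝ) (gradComp φ i x) (gradComp φ i x)
    have hn : ∀ i, ‖gradComp φ i x‖ ^ 2 = ∫ X, gradComp φ i x X * gradComp φ i x X ∂μ := fun i => by
      rw [← real_inner_self_eq_norm_sq, L2.inner_def]
      simp [← sq, hμ]
    rw [hBeq, hn, hn, ← integral_add (hsq 0) (hsq 1), ← integral_const_mul]
    refine integral_mono_ae (((hsq 0).add (hsq 1)).const_mul lam)
      (integrable_finsetSum _ fun i _ => integrable_finsetSum _ fun j _ => hSint i j x x) ?_
    filter_upwards [hA.elliptic] with X hX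
    -- Ellipticity is applied pointwise to the gradient itself.
    have := hX ![gradComp φ 0 x X, gradComp φ 1 x X]
    simp only [dotProduct, Matrix.mulVec, Fin.sum_univ_two, Matrix.cons_val_zero,
      Matrix.cons_val_one] at this
    simp only [Fin.sum_univ_two]
    linarith

/-! ### The Dirichlet problem -/

/-- The families of vanishing trace. -/
def zeroTraceSpace (φ : ℝ → ℝ) : Submodule ℝ (Ambient φ) :=
  traceSpace φ ⊓
    LinearMap.ker (PiLp.proj 2 (fun s => Lp ℝ 2 (slotMeasure φ s)) (.inr true) :
      Ambient φ →L[ℝ] Lp ℝ 2 (slotMeasure φ (.inr true))).toLinearMap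

theorem mem_zeroTraceSpace {φ : ℝ → ℝ} {x : Ambient φ} :
    x ∈ zeroTraceSpace φ ↔ x ∈ traceSpace φ ∧ x (.inr true) = 0 := Iff.rfl

theorem isClosed_zeroTraceSpace (φ : ℝ → ℝ) : IsClosed (zeroTraceSpace φ : Set (Ambient φ)) :=
  (smoothPart φ).isClosed_topologicalClosure.inter (ContinuousLinearMap.isClosed_ker _)

/-- Without a trace term, `norm_interior_le` bounds the function by its vertical derivative alone;
`12 = 3 · 4`. -/
theorem norm_sq_le_gradComp {φ : ℝ → ℝ} {K : ℝ≥0} (hφ : LipschitzWith K φ) {x : Ambient φ}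
    (hx : x ∈ zeroTraceSpace φ) : ‖x‖ ^ 2 ≤ (1 + 12 * (1 + 2 * |φ 0| + 2 * K) ^ 2) *
      (‖gradComp φ 0 x‖ ^ 2 + ‖gradComp φ 1 x‖ ^ 2) := by
  have h1 := norm_interior_le hφ hx.1
  rw [(mem_zeroTraceSpace.1 hx).2] at h1
  rw [PiLp.norm_sq_eq_of_L2, Fintype.sum_sum_type, Fintype.sum_bool, Fin.sum_univ_two,
    (mem_zeroTraceSpace.1 hx).2]
  change ‖gradComp φ 0 x‖ ^ 2 + ‖gradComp φ 1 x‖ ^ 2 +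
    (‖(0 : Lp ℝ 2 (slotMeasure φ (.inr true)))‖ ^ 2 + ‖x (.inr false)‖ ^ 2) ≤ _
  change ‖x (.inr false)‖ ^ 2 ≤ 3 * (1 + 2 * |φ 0| + 2 * K) ^ 2 * (4 * ‖gradComp φ 1 x‖ ^ 2 +
    2 * ‖(0 : Lp ℝ 2 (slotMeasure φ (.inr true)))‖ ^ 2) at h1
  rw [norm_zero] at h1 ⊢
  have : 0 ≤ 12 * (1 + 2 * |φ 0| + 2 * (K : ℝ)) ^ 2 * ‖gradComp φ 0 x‖ ^ 2 := by positivity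
  linarith

/-- The Lax-Milgram solution with the trace of a given family. -/
theorem exists_solution {φ : ℝ → ℝ} {B : Ambient φ →L[ℝ] Ambient φ →L[ℝ] ℝ} {c M : ℝ} (hc : 0 < c)
    (hcoer : ∀ x ∈ zeroTraceSpace φ, c * ‖x‖ ^ 2 ≤ B x x) (hB : ∀ x y, |B x y| ≤ M * ‖x‖ * ‖y‖)
    {F : Ambient φ} (hF : F ∈ traceSpace φ) :
    ∃ x ∈ traceSpace φ, x (.inr true) = F (.inr true) ∧ (∀ v ∈ zeroTraceSpace φ, B x v = 0) ∧
      ‖x‖ ≤ (1 + M / c) * ‖F‖ := by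
  have : CompleteSpace (zeroTraceSpace φ) := (isClosed_zeroTraceSpace φ).completeSpace_coe
  set ι := (zeroTraceSpace φ).subtypeL with hι
  have hco : IsCoercive (B.bilinearComp ι ι) := ⟨c, hc, fun u => by
    have := hcoer u u.2
    rw [sq, ← mul_assoc] at this
    exact this⟩
  -- The correction `w` solves `B w v = -B F v` on zero-trace vectors; `z` is the Riesz
  -- representative of the right-hand side.
  set z := (InnerProductSpace.toDual ℝ (zeroTraceSpace φ)).symm (-((B F).comp ι)) with hz
  set w := hco.continuousLinearEquivOfBilin.symm z with hw
  have hsol : ∀ v : zeroTraceSpace φ, B w v = -B F v := fun v => by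
    have h1 := hco.continuousLinearEquivOfBilin_apply w v
    rw [hw, ContinuousLinearEquiv.apply_symm_apply, hz, InnerProductSpace.toDual_symm_apply] at h1
    exact h1.symm
  have hwn : ‖(w : Ambient φ)‖ ≤ M / c * ‖F‖ := by
    have h1 := hcoer w w.2
    have h2 := hB F w
    rw [hsol w] at h1
    have h3 : c * ‖(w : Ambient φ)‖ ^ 2 ≤ M * ‖F‖ * ‖(w : Ambient φ)‖ :=
      h1.trans ((neg_le_abs _).trans h2)
    rcases (norm_nonneg (w : Ambient φ)).eq_or_lt with h0 | h0
    · rw [← h0]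
      -- `M` is not assumed nonnegative; its sign follows from the bound on `B F F` unless `F = 0`.
      have hM : 0 ≤ M * ‖F‖ := by
        rcases (norm_nonneg F).eq_or_lt with hF0 | hF0
        · rw [← hF0, mul_zero]
        · have := (abs_nonneg _).trans (hB F F)
          exact nonneg_of_mul_nonneg_left this hF0
      rw [div_mul_eq_mul_div]
      exact div_nonneg hM hc.le
    · rw [div_mul_eq_mul_div, le_div_iff₀ hc]
      rw [sq, ← mul_assoc] at h3
      linarith [le_of_mul_le_mul_right h3 h0]
  refine ⟨F + w, (traceSpace φ).add_mem hF w.2.1, ?_, fun v hv => ?_, ?_⟩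
  · have := (mem_zeroTraceSpace.1 w.2).2
    rw [PiLp.add_apply, this, add_zero]
  · rw [map_add, _root_.add_apply, hsol ⟨v, hv⟩, add_neg_cancel]
  · calc ‖F + w‖ ≤ ‖F‖ + ‖(w : Ambient φ)‖ := norm_add_le _ _
      _ ≤ ‖F‖ + M / c * ‖F‖ := by gcongr
      _ = _ := by ring

/-- Both integrands involve only gradients, and the gradient components of a vector of `traceSpace`
agree almost everywhere with the chosen weak gradient. -/
theorem form_eq {φ : ℝ → ℝ} (hφ : Continuous φ) (A : ℝ × ℝ → Matrix (Fin 2) (Fin 2) ℝ)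
    {x y : Ambient φ} (hx : x ∈ traceSpace φ) (hy : y ∈ traceSpace φ)
    {u g v h : ℝ × ℝ → ℝ} {G H : ℝ × ℝ → Fin 2 → ℝ} (hxu : Represents x (slotFun u G g))
    (hyv : Represents y (slotFun v H h)) :
    ∫ X in region φ, ∑ i, ∑ j, A X i j * gradComp φ j x X * gradComp φ i y X =
      ∫ X in region φ, (A X *ᵥ weakGrad (region φ) u X) ⬝ᵥ weakGrad (region φ) v X := by
  have hΩ := isOpen_region hφ
  have key : ∀ {x : Ambient φ}, x ∈ traceSpace φ → ∀ {u g : ℝ × ℝ → ℝ} {G : ℝ × ℝ → Fin 2 → ℝ},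
      Represents x (slotFun u G g) → ∀ i, gradComp φ i x =ᵐ[volume.restrict (region φ)]
        fun X => weakGrad (region φ) u X i := fun hx _ _ _ hr i =>
    EventuallyEq.trans (hr (.inl i)) ((hr.isWeakGrad hφ hx).weakGrad_ae_eq hΩ i).symm
  refine integral_congr_ae ?_
  filter_upwards [key hx hxu 0, key hx hxu 1, key hy hyv 0, key hy hyv 1] with X h1 h2 h3 h4
  simp only [Fin.sum_univ_two, dotProduct, Matrix.mulVec, h1, h2, h3, h4]
  ring

theorem rep_self {φ : ℝ → ℝ} (x : Ambient φ) {g : ℝ × ℝ → ℝ}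
    (hg : x (.inr true) =ᵐ[slotMeasure φ (.inr true)] g) :
    Represents x (slotFun (x (.inr false)) (fun X i => x (.inl i) X) g) := by
  intro s
  rcases s with i | (_ | _)
  · exact ae_eq_refl _
  · exact ae_eq_refl _
  · exact hg

end LipGraph

end

theorem mainTheorem9 (φ : ℝ → ℝ) (hφ : ∃ K : ℝ≥0, LipschitzWith K φ)
    (lam Lam : ℝ) (hlam : 0 < lam) :
    ∃ C : ℝ≥0, ∀ A : ℝ × ℝ → Matrix (Fin 2) (Fin 2) ℝ, IsEllipticCoeff (region φ) lam Lam A →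
      ∀ f₀ : ℝ × ℝ → ℝ, bdrySobNorm φ f₀ < ⊤ → MemLp f₀ (7 / 6) (surf φ) →
        MemLp f₀ (17 / 6) (surf φ) →
        ∃ u : ℝ × ℝ → ℝ, SolvesDirichlet φ A f₀ u ∧
          (∀ v, SolvesDirichlet φ A f₀ v → v =ᵐ[volume.restrict (region φ)] u) ∧
          sobNorm (region φ) u ≤
            C * (bdrySobNorm φ f₀ + eLpNorm f₀ (7 / 6) (surf φ) +
              eLpNorm f₀ (17 / 6) (surf φ)) := by
  obtain ⟨K, hK⟩ := hφ
  have hc := hK.continuous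
  obtain ⟨C, hC⟩ := exists_extension hK
  set P : ℝ := 1 + 12 * (1 + 2 * |φ 0| + 2 * K) ^ 2 with hP
  have hP0 : 0 < P := by positivity
  have hcP : 0 < lam / P := by positivity
  -- The Lax-Milgram factor `1 + M/c`, with `M = 4|Λ|` and `c = λ/P`, times the extension constant;
  -- neither depends on `A` or `f₀`.
  refine ⟨Real.toNNReal (1 + 4 * |Lam| / (lam / P)) * C, fun A hA f₀ hf₀ hf₁ _ => ?_⟩
  obtain ⟨B, hBint, hBb, hBc⟩ := exists_form hA
  have hcoer : ∀ x ∈ zeroTraceSpace φ, lam / P * ‖x‖ ^ 2 ≤ B x x := fun x hx => by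
    refine le_trans ?_ (hBc x)
    rw [div_mul_eq_mul_div, div_le_iff₀ hP0, mul_assoc]
    refine mul_le_mul_of_nonneg_left ?_ hlam.le
    rw [mul_comm]
    exact norm_sq_le_gradComp hK hx
  obtain ⟨F, hF, hFt, hFn⟩ := hC f₀ hf₀
  obtain ⟨x, hx, hxF, hxB, hxn⟩ := exists_solution hcP hcoer hBb hF
  have hrep := rep_self x (g := f₀) (by rw [hxF]; exact hFt)
  have hf₀m : AEStronglyMeasurable f₀ (surf φ) := hf₁.1
  have hf₀b : bdryNorm φ f₀ < ⊤ := by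
    refine lt_top_of_sq_lt_top ?_
    rw [bdryNorm_eq]
    exact ENNReal.pow_lt_top (hrep.memLp (.inr true)).2
  refine ⟨x (.inr false), ⟨hrep.memSob hc hx, hrep.hasTrace hc hx, fun v hv => ?_⟩,
    fun v hv => ?_, ?_⟩
  · obtain ⟨y, hy, hyv⟩ := exists_mem_traceSpace hc hv.1 hv.2 aestronglyMeasurable_const
      (by simp [bdryNorm])
    rw [← form_eq hc A hx hy hrep hyv, ← hBint]
    refine hxB y (mem_zeroTraceSpace.2 ⟨hy, Lp.ext ?_⟩)
    exact (hyv (.inr true)).trans (Lp.coeFn_zero _ _ _).symm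
  · obtain ⟨y, hy, hyv⟩ := exists_mem_traceSpace hc hv.1 hv.2.1 hf₀m hf₀b
    -- The difference of two solutions has zero trace, hence is an admissible test function, and
    -- coercivity forces it to vanish.
    have hd : y - x ∈ zeroTraceSpace φ := by
      refine mem_zeroTraceSpace.2 ⟨(traceSpace φ).sub_mem hy hx, ?_⟩
      rw [PiLp.sub_apply, sub_eq_zero]
      exact Lp.ext ((hyv (.inr true)).trans (hrep (.inr true)).symm)
    have hdrep := rep_self (y - x) (g := 0) (by
      rw [(mem_zeroTraceSpace.1 hd).2]; exact Lp.coeFn_zero _ _ _)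
    have h1 : B y (y - x) = 0 := by
      rw [hBint, form_eq hc A hy hd.1 hyv hdrep]
      exact hv.2.2 _ ⟨hdrep.memSob hc hd.1, hdrep.hasTrace hc hd.1⟩
    have h2 : B (y - x) (y - x) = 0 := by
      rw [map_sub B y x, _root_.sub_apply, h1, hxB _ hd, sub_zero]
    have h3 := hcoer _ hd
    rw [h2] at h3
    have h4 : y - x = 0 := by
      have : ‖y - x‖ ^ 2 ≤ 0 := nonpos_of_mul_nonpos_right h3 hcP
      exact norm_eq_zero.1 (pow_eq_zero_iff two_ne_zero |>.1 (le_antisymm this (sq_nonneg _)))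
    rw [sub_eq_zero] at h4
    subst h4
    -- The interior weight vanishes nowhere, so equality almost everywhere for the weighted measure
    -- is equality for Lebesgue measure.
    exact (interior_ac φ).ae_eq (hyv (.inr false)).symm
  · refine (hrep.sobNorm_le hc hx).trans ?_
    have h1 : ‖x‖ₑ ≤ (Real.toNNReal (1 + 4 * |Lam| / (lam / P)) : ℝ≥0∞) * ‖F‖ₑ := by
      rw [← ofReal_norm, ← ofReal_norm F]
      refine (ENNReal.ofReal_le_ofReal hxn).trans (le_of_eq ?_)
      rw [ENNReal.ofReal_mul (by positivity)]
      rfl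
    refine h1.trans ?_
    rw [ENNReal.coe_mul, mul_assoc]
    refine mul_le_mul_right (hFn.trans (mul_le_mul_right ?_ _)) _
    rw [add_assoc]
    exact le_self_add
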